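/- There exists a universal constant $C>0$ such that the following holds. Let $G=(V,E)$ be a connected simple graph (finite or infinite) with at least two vertices and all degrees bounded by $M<\infty$. Let $P(x,\cdot)$ be the one-step transition probabilities of the lazy simple random walk on $G$ (which stays put with probability $1/2$ and otherwise moves to a uniformly random neighbour), let $d_G$ be the graph distance, and let $\mathcal W_1(\mu,\nu)=\inf_\pi \sum_{u,v} d_G(u,v)\,\pi(u,v)$, the infimum being over all couplings $\pi$ of $\mu$ and $\nu$, be the $L^1$-Wasserstein distance. Suppose that $G$ has non-negative Ollivier–Ricci curvature, that is, $1-\mathcal W_1(P(x,\cdot),P(y,\cdot))\ge 0$ for every edge $\{x,y\}\in E$. For a finite set $W\subseteq V$ let $\partial W$ be the set of edges with exactly one endpoint in $W$, and let $$\Phi(n)=\inf\left\{\frac{|\partial W|}{\sum_{w\in W}\deg(w)} : \emptyset\ne W\subseteq V \text{ finite},\ \sum_{w\in W}\deg(w)\le n\right\}$$ be the isoperimetric profile of $G$. Then $$\Phi(n)\le C\sqrt{\frac{M\log M}{\log n}}$$ for every integer $n\ge 2$ for which the infimum is over a non-empty family, that is, for which some vertex has degree at most $n$. -/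

import Mathlib

open scoped ENNReal

/-- The set of edges of `G` with one endpoint in `W` and the other endpoint not in `W`. -/
def edgeBoundary {V : Type*} (G : SimpleGraph V) (W : Finset V) : Set (Sym2 V) :=
  {e | e ∈ G.edgeSet ∧ ∃ x ∈ W, ∃ y ∉ W, e = s(x, y)}

/-- The volume of a finite set of vertices: the sum of the degrees of its elements. -/
def vertexVolume {V : Type*} (G : SimpleGraph V) [G.LocallyFinite] (W : Finset V) : ℕ :=
  ∑ w ∈ W, G.degree w

/-- The isoperimetric profile: the infimum of the boundary-to-volume ratio over the non-empty
finite sets of vertices of volume at most `n`. It takes values in `[0, ∞]`, and equals `∞` if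
there is no such set. -/
noncomputable def isoperimetricProfile {V : Type*} (G : SimpleGraph V) [G.LocallyFinite]
    (n : ℕ) : ℝ≥0∞ :=
  ⨅ (W : Finset V) (_ : W.Nonempty) (_ : vertexVolume G W ≤ n),
    ((edgeBoundary G W).ncard : ℝ≥0∞) / (vertexVolume G W : ℝ≥0∞)

open Classical in
/-- The law of one step of the (non-lazy) simple random walk from `x`: a uniform neighbour of `x`
(the walk does not move if `x` has no neighbour). -/
noncomputable def simpleStep {V : Type*} (G : SimpleGraph V) [G.LocallyFinite] (x : V) : PMF V :=
  if h : (G.neighborFinset x).Nonempty then PMF.uniformOfFinset (G.neighborFinset x) h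
  else PMF.pure x

/-- The one-step transition probabilities `P(x, ·)` of the lazy simple random walk: with
probability `1/2` the walk stays at `x`, otherwise it makes a simple random walk step. -/
noncomputable def lazyStep {V : Type*} (G : SimpleGraph V) [G.LocallyFinite] (x : V) : PMF V :=
  (PMF.uniformOfFintype Bool).bind fun b => if b then PMF.pure x else simpleStep G x

/-- The `L¹`-Wasserstein distance, with respect to the graph distance, of two probability
distributions on the vertices: the infimum over all couplings of the expected distance. -/
noncomputable def wassersteinDist {V : Type*} (G : SimpleGraph V) (μ ν : PMF V) : ℝ≥0∞ :=
  ⨅ (π : PMF (V × V)) (_ : π.map Prod.fst = μ ∧ π.map Prod.snd = ν),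
    ∑' p : V × V, π p * (G.dist p.1 p.2 : ℝ≥0∞)

/-- The Ollivier–Ricci curvature `1 - W₁(P(x, ·), P(y, ·))`. -/
noncomputable def ollivierRicci {V : Type*} (G : SimpleGraph V) [G.LocallyFinite]
    (x y : V) : EReal :=
  1 - (wassersteinDist G (lazyStep G x) (lazyStep G y) : EReal)

/-- Non-negative Ollivier–Ricci curvature: the curvature of every edge is non-negative. -/
def HasNonnegOllivierRicci {V : Type*} (G : SimpleGraph V) [G.LocallyFinite] : Prop :=
  ∀ x y : V, G.Adj x y → 0 ≤ ollivierRicci G x y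

/-! Write p_t for the t-step kernel of the lazy walk.

Non-negative curvature makes p_t regularising. By gluing along geodesics, the one-step laws from any
two vertices can be coupled with expected distance at most (arbitrarily close to) the original
distance. Laziness and a swap of partners yield some genuine randomness in that distance, so if w is
an increasing concave modulus of continuity of u, one step of the walk improves w at least as much
as one step of the heat equation on ℕ, absorbed at 0, with diffusivity m ≤ 1/(2 deg) at every vertex
(`IsCoupling.avg_sub_avg_le`). Hence the ℓ¹ distance between p_t(x,·) and p_t(y,·) for adjacent x, y
is at most 2 `heat m t 1`, which is of order 1/√(mt).

Isoperimetry follows by applying the co-area inequality to x ↦ F(x) p_t(x,z) for each z. Its support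
lies in a ball of radius t about z, so has volume at most M(M+1)^t ≤ n. Summing over z makes p_t
integrate to 1 and leaves Φ(n) ∑ deg·F ≤ ∑|∇F| + 2 `heat m t 1` ∑ deg·F. It remains to find a
finitely supported F ≥ 0 whose gradient is negligible against its mass (`exists_gradient_le`).

Such an F is p_s(·,o) for a suitable s. The ℓ¹ bound makes the entropy of the walk grow sublinearly
(`sum_negMulLog_kernel_le`), while each step produces entropy at least quadratic in the normalised
gradient (`sum_gradient_le`); the gradient therefore cannot stay bounded below. Finally t of order
log n / log M, with m = 1/(2M), gives the rate. -/

namespace LazyWalk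

variable {V : Type*} (G : SimpleGraph V) [G.LocallyFinite]

/-! ### One step of the lazy walk as a finite weighted average. -/

/-- The transition operator of the lazy simple random walk. -/
noncomputable def avg (f : V → ℝ) (x : V) : ℝ :=
  f x / 2 + (∑ y ∈ G.neighborFinset x, f y) / (2 * G.degree x)

/-- The closed neighbourhood of a vertex. -/
def closedNbhd (x : V) : Finset V :=
  Finset.cons x (G.neighborFinset x) (by simp)

open Classical in
/-- The transition probabilities of the lazy simple random walk, as real numbers. -/
noncomputable def weight (x a : V) : ℝ :=
  if a = x then 1 / 2 else if G.Adj x a then 1 / (2 * G.degree x) else 0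

variable {G}

@[simp] lemma mem_closedNbhd {x a : V} : a ∈ closedNbhd G x ↔ a = x ∨ G.Adj x a := by
  simp [closedNbhd]

lemma weight_self (x : V) : weight G x x = 1 / 2 := by simp [weight]

lemma weight_adj {x a : V} (h : G.Adj x a) : weight G x a = 1 / (2 * G.degree x) := by
  simp [weight, h, h.ne']

lemma weight_nonneg (x a : V) : 0 ≤ weight G x a := by
  unfold weight; split_ifs <;> positivity

lemma sum_weight_mul (f : V → ℝ) (x : V) :
    ∑ a ∈ closedNbhd G x, weight G x a * f a = avg G f x := by
  have h : ∑ a ∈ G.neighborFinset x, weight G x a * f a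
      = ∑ a ∈ G.neighborFinset x, 1 / (2 * (G.degree x : ℝ)) * f a :=
    Finset.sum_congr rfl fun a ha => by rw [weight_adj (by simpa using ha)]
  rw [closedNbhd, Finset.sum_cons, h, weight_self, ← Finset.mul_sum, avg]
  ring

lemma avg_const {x : V} (hx : 0 < G.degree x) (c : ℝ) : avg G (fun _ => c) x = c := by
  have : (G.degree x : ℝ) ≠ 0 := by positivity
  simp only [avg, Finset.sum_const, SimpleGraph.card_neighborFinset_eq_degree, nsmul_eq_mul]
  field_simp
  ring

lemma sum_weight {x : V} (hx : 0 < G.degree x) : ∑ a ∈ closedNbhd G x, weight G x a = 1 := by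
  have := sum_weight_mul (G := G) (fun _ => 1) x
  simpa [avg_const hx] using this

lemma avg_mono {f g : V → ℝ} (h : ∀ x, f x ≤ g x) (x : V) : avg G f x ≤ avg G g x := by
  unfold avg
  gcongr <;> apply h

lemma weight_pos (hd : ∀ x, 0 < G.degree x) {x a : V} (ha : a ∈ closedNbhd G x) :
    0 < weight G x a := by
  rw [mem_closedNbhd] at ha
  have := hd x
  rcases ha with rfl | ha
  · rw [weight_self]; norm_num
  · rw [weight_adj ha]; positivity

lemma weight_eq_zero {x a : V} (ha : a ∉ closedNbhd G x) : weight G x a = 0 := by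
  rw [mem_closedNbhd, not_or] at ha
  simp [weight, ha.1, ha.2]

open Classical in
lemma simpleStep_apply {x : V} (hx : 0 < G.degree x) (a : V) :
    simpleStep G x a = if a ∈ G.neighborFinset x then (G.degree x : ℝ≥0∞)⁻¹ else 0 := by
  have h : (G.neighborFinset x).Nonempty := by
    rwa [← Finset.card_pos, SimpleGraph.card_neighborFinset_eq_degree]
  rw [simpleStep, dif_pos h, PMF.uniformOfFinset_apply]
  simp

lemma toReal_lazyStep {x : V} (hx : 0 < G.degree x) (a : V) :
    (lazyStep G x a).toReal = weight G x a := by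
  classical
  have h2 : ((2 : ℝ≥0∞)⁻¹).toReal = 1 / 2 := by simp
  rw [lazyStep, PMF.bind_apply, tsum_fintype, Fintype.sum_bool]
  simp only [PMF.uniformOfFintype_apply, Fintype.card_bool, if_true, Bool.false_eq_true, if_false,
    Nat.cast_ofNat]
  rw [ENNReal.toReal_add (ENNReal.mul_ne_top (by simp) (PMF.apply_ne_top _ _))
    (ENNReal.mul_ne_top (by simp) (PMF.apply_ne_top _ _)), ENNReal.toReal_mul, ENNReal.toReal_mul,
    h2, PMF.pure_apply, simpleStep_apply hx, weight]
  by_cases hax : a = x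
  · subst hax; simp
  · by_cases hadj : G.Adj x a
    · simp [hax, hadj]; ring
    · simp [hax, hadj]

/-! ### Couplings supplied by curvature. -/

variable (G) in
/-- A finite real-valued coupling of the one-step distributions from `x` and from `y` whose
expected distance is at most `r`. -/
structure IsCoupling (x y : V) (r : ℝ) (c : V → V → ℝ) : Prop where
  nonneg : ∀ a b, 0 ≤ c a b
  left : ∀ a, ∑ b ∈ closedNbhd G y, c a b = weight G x a
  right : ∀ b, ∑ a ∈ closedNbhd G x, c a b = weight G y b
  cost : ∑ a ∈ closedNbhd G x, ∑ b ∈ closedNbhd G y, c a b * (G.dist a b : ℝ) ≤ r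

/-- The Wasserstein distance is an infimum, hence the slack ε. Both marginals live on closed
neighbourhoods, so a coupling vanishes off a finite rectangle and becomes a real matrix. -/
lemma exists_isCoupling_of_adj (hd : ∀ x, 0 < G.degree x) (hG : HasNonnegOllivierRicci G)
    {x y : V} (hxy : G.Adj x y) {ε : ℝ} (hε : 0 < ε) : ∃ c, IsCoupling G x y (1 + ε) c := by
  classical
  have hW : wassersteinDist G (lazyStep G x) (lazyStep G y) ≤ 1 := by
    have := hG x y hxy
    have h1 : (1 : EReal) ≠ ⊤ := EReal.coe_ne_top 1
    have h2 : (1 : EReal) ≠ ⊥ := EReal.coe_ne_bot 1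
    rw [ollivierRicci, EReal.sub_nonneg (Or.inl h1) (Or.inl h2)] at this
    exact_mod_cast this
  have hlt : wassersteinDist G (lazyStep G x) (lazyStep G y) < ENNReal.ofReal (1 + ε) := by
    refine hW.trans_lt ?_
    rw [← ENNReal.ofReal_one]
    exact (ENNReal.ofReal_lt_ofReal_iff (by linarith)).2 (by linarith)
  simp only [wassersteinDist, iInf_lt_iff] at hlt
  obtain ⟨π, ⟨h1, h2⟩, hcost⟩ := hlt
  have hl : ∀ a, ∑' b, π (a, b) = lazyStep G x a := by
    intro a
    rw [← h1, PMF.map_apply, ENNReal.tsum_prod']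
    refine Eq.symm ((tsum_eq_single a fun a' ha' => ?_).trans ?_)
    · simp [ha'.symm]
    · simp
  have hr : ∀ b, ∑' a, π (a, b) = lazyStep G y b := by
    intro b
    rw [← h2, PMF.map_apply, ENNReal.tsum_prod', ENNReal.tsum_comm]
    refine Eq.symm ((tsum_eq_single b fun b' hb' => ?_).trans ?_)
    · simp [hb'.symm]
    · simp
  have zl : ∀ a b, a ∉ closedNbhd G x → π (a, b) = 0 := by
    intro a b ha
    have : lazyStep G x a = 0 := by
      have h := toReal_lazyStep (hd x) a
      rw [weight_eq_zero ha, ENNReal.toReal_eq_zero_iff] at h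
      exact h.resolve_right (PMF.apply_ne_top _ _)
    rw [← hl a, ENNReal.tsum_eq_zero] at this
    exact this b
  have zr : ∀ a b, b ∉ closedNbhd G y → π (a, b) = 0 := by
    intro a b hb
    have : lazyStep G y b = 0 := by
      have h := toReal_lazyStep (hd y) b
      rw [weight_eq_zero hb, ENNReal.toReal_eq_zero_iff] at h
      exact h.resolve_right (PMF.apply_ne_top _ _)
    rw [← hr b, ENNReal.tsum_eq_zero] at this
    exact this a
  refine ⟨fun a b => (π (a, b)).toReal, fun _ _ => ENNReal.toReal_nonneg, fun a => ?_,
    fun b => ?_, ?_⟩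
  · rw [← toReal_lazyStep (hd x), ← hl a, tsum_eq_sum (s := closedNbhd G y) fun b hb => zr a b hb,
      ENNReal.toReal_sum fun _ _ => PMF.apply_ne_top _ _]
  · rw [← toReal_lazyStep (hd y), ← hr b, tsum_eq_sum (s := closedNbhd G x) fun a ha => zl a b ha,
      ENNReal.toReal_sum fun _ _ => PMF.apply_ne_top _ _]
  · have hsum : ∑ p ∈ closedNbhd G x ×ˢ closedNbhd G y, π p * (G.dist p.1 p.2 : ℝ≥0∞)
        ≤ ENNReal.ofReal (1 + ε) := (ENNReal.sum_le_tsum _).trans hcost.le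
    have := ENNReal.toReal_mono ENNReal.ofReal_ne_top hsum
    rw [ENNReal.toReal_ofReal (by linarith), ENNReal.toReal_sum fun p _ =>
      ENNReal.mul_ne_top (PMF.apply_ne_top _ _) (by simp), Finset.sum_product] at this
    simpa [ENNReal.toReal_mul] using this

/-- Gluing of two couplings along their common marginal. -/
lemma IsCoupling.glue (hd : ∀ x, 0 < G.degree x) (hconn : G.Connected) {x y z : V} {r s : ℝ}
    {c e : V → V → ℝ} (hc : IsCoupling G x y r c) (he : IsCoupling G y z s e) :
    ∃ k, IsCoupling G x z (r + s) k := by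
  have hp : ∀ v ∈ closedNbhd G y, weight G y v ≠ 0 := fun v hv => (weight_pos hd hv).ne'
  have hleft : ∀ a, ∀ v ∈ closedNbhd G y,
      ∑ b ∈ closedNbhd G z, c a v * e v b / weight G y v = c a v := by
    intro a v hv
    rw [← Finset.sum_div, ← Finset.mul_sum, he.left, mul_div_assoc, div_self (hp v hv), mul_one]
  have hright : ∀ b, ∀ v ∈ closedNbhd G y,
      ∑ a ∈ closedNbhd G x, c a v * e v b / weight G y v = e v b := by
    intro b v hv
    rw [← Finset.sum_div, ← Finset.sum_mul, hc.right, mul_comm, mul_div_assoc, div_self (hp v hv),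
      mul_one]
  have hnn : ∀ a v b, 0 ≤ c a v * e v b / weight G y v := fun a v b =>
    div_nonneg (mul_nonneg (hc.nonneg _ _) (he.nonneg _ _)) (weight_nonneg _ _)
  -- Given the middle vertex v, the two outer vertices are taken independent.
  refine ⟨fun a b => ∑ v ∈ closedNbhd G y, c a v * e v b / weight G y v,
    fun a b => Finset.sum_nonneg fun v _ => hnn a v b, fun a => ?_, fun b => ?_, ?_⟩
  · rw [Finset.sum_comm, Finset.sum_congr rfl (hleft a), hc.left]
  · rw [Finset.sum_comm, Finset.sum_congr rfl (hright b), he.right]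
  · calc ∑ a ∈ closedNbhd G x, ∑ b ∈ closedNbhd G z,
          (∑ v ∈ closedNbhd G y, c a v * e v b / weight G y v) * (G.dist a b : ℝ)
        ≤ ∑ a ∈ closedNbhd G x, ∑ b ∈ closedNbhd G z, ∑ v ∈ closedNbhd G y,
          ((c a v * e v b / weight G y v) * (G.dist a v : ℝ)
            + (c a v * e v b / weight G y v) * (G.dist v b : ℝ)) := by
          refine Finset.sum_le_sum fun a _ => Finset.sum_le_sum fun b _ => ?_
          rw [Finset.sum_mul]
          refine Finset.sum_le_sum fun v _ => ?_
          rw [← mul_add]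
          refine mul_le_mul_of_nonneg_left ?_ (hnn a v b)
          exact_mod_cast hconn.dist_triangle
      _ = ∑ a ∈ closedNbhd G x, ∑ v ∈ closedNbhd G y, c a v * (G.dist a v : ℝ)
          + ∑ v ∈ closedNbhd G y, ∑ b ∈ closedNbhd G z, e v b * (G.dist v b : ℝ) := by
          simp only [Finset.sum_add_distrib]
          congr 1
          · refine Finset.sum_congr rfl fun a _ => ?_
            rw [Finset.sum_comm]
            refine Finset.sum_congr rfl fun v hv => ?_
            rw [← Finset.sum_mul, hleft a v hv]
          · rw [Finset.sum_comm' (t' := closedNbhd G z) (s' := fun _ => closedNbhd G x)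
              (by simp)]
            rw [Finset.sum_comm' (s := closedNbhd G y) (t' := closedNbhd G z)
              (s' := fun _ => closedNbhd G y) (by simp)]
            refine Finset.sum_congr rfl fun b _ => ?_
            rw [Finset.sum_comm]
            refine Finset.sum_congr rfl fun v hv => ?_
            rw [← Finset.sum_mul, hright b v hv]
      _ ≤ r + s := add_le_add hc.cost he.cost

/-- The first step of a geodesic. -/
lemma exists_adj_dist {V : Type*} {G : SimpleGraph V} (hconn : G.Connected) {x y : V} {d : ℕ} (h : G.dist x y = d + 1) :
    ∃ x', G.Adj x x' ∧ G.dist x' y = d := by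
  obtain ⟨p, hp⟩ := hconn.exists_walk_length_eq_dist x y
  cases p with
  | nil => simp at h
  | @cons _ v _ hadj q =>
    refine ⟨v, hadj, ?_⟩
    have h1 : G.dist v y ≤ q.length := SimpleGraph.dist_le q
    have h2 : G.dist x y ≤ G.dist x v + G.dist v y := hconn.dist_triangle
    rw [SimpleGraph.dist_eq_one_iff_adj.2 hadj] at h2
    rw [SimpleGraph.Walk.length_cons] at hp
    omega

/-- Edge couplings are glued along a geodesic; half of the slack is spent on its first edge and half
on the rest. -/
lemma exists_isCoupling (hd : ∀ x, 0 < G.degree x) (hconn : G.Connected)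
    (hG : HasNonnegOllivierRicci G) (d : ℕ) {x y : V} (hxy : G.dist x y = d + 1) {ε : ℝ}
    (hε : 0 < ε) : ∃ c, IsCoupling G x y (d + 1 + ε) c := by
  induction d generalizing x ε with
  | zero =>
    simpa using exists_isCoupling_of_adj hd hG (SimpleGraph.dist_eq_one_iff_adj.1 hxy) hε
  | succ d ih =>
    obtain ⟨x', hadj, hdist⟩ := exists_adj_dist hconn hxy
    obtain ⟨c, hc⟩ := exists_isCoupling_of_adj hd hG hadj (half_pos hε)
    obtain ⟨e, he⟩ := ih hdist (half_pos hε)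
    obtain ⟨k, hk⟩ := hc.glue hd hconn he
    refine ⟨k, ?_⟩
    convert hk using 1
    push_cast; ring

/-! ### The comparison heat equation on the half-line. -/

/-- The solution of the discrete heat equation on `ℕ` with diffusivity `m`, Dirichlet condition
at `0` and initial value `1` away from `0`. -/
noncomputable def heat (m : ℝ) : ℕ → ℕ → ℝ
  | _, 0 => 0
  | 0, _ + 1 => 1
  | t + 1, d + 1 => heat m t (d + 1) + m * (heat m t (d + 2) - 2 * heat m t (d + 1) + heat m t d)

section Heat

variable {m : ℝ}

@[simp] lemma heat_zero_right (t : ℕ) : heat m t 0 = 0 := by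
  cases t <;> rfl

lemma heat_zero_left (d : ℕ) : heat m 0 (d + 1) = 1 := rfl

lemma heat_succ (t d : ℕ) : heat m (t + 1) (d + 1) =
    heat m t (d + 1) + m * (heat m t (d + 2) - 2 * heat m t (d + 1) + heat m t d) := rfl

/-- Second differences satisfy the same averaging recursion, with coefficients m, 1 - 2m, m that are
non-negative as m ≤ 1/2; at the boundary the missing term is zero. -/
lemma heat_concave (h0 : 0 ≤ m) (h1 : m ≤ 1 / 2) (t d : ℕ) :
    heat m t (d + 2) - 2 * heat m t (d + 1) + heat m t d ≤ 0 := by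
  induction t generalizing d with
  | zero => cases d <;> norm_num [heat_zero_left]
  | succ t ih =>
    have a := ih d
    have b := mul_nonpos_of_nonneg_of_nonpos h0 (ih (d + 1))
    have a' := mul_nonpos_of_nonneg_of_nonpos (by linarith : 0 ≤ 1 - 2 * m) a
    cases d with
    | zero =>
      simp only [heat_succ, heat_zero_right, zero_add] at *
      linarith
    | succ d =>
      have c := mul_nonpos_of_nonneg_of_nonpos h0 (ih d)
      simp only [heat_succ] at *
      linarith

lemma heat_mono (h0 : 0 ≤ m) (h1 : m ≤ 1 / 2) (t d : ℕ) : heat m t d ≤ heat m t (d + 1) := by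
  induction t generalizing d with
  | zero => cases d <;> norm_num [heat_zero_left]
  | succ t ih =>
    have a := mul_nonneg (by linarith : 0 ≤ 1 - 2 * m) (sub_nonneg.2 (ih d))
    have b := mul_nonneg h0 (sub_nonneg.2 (ih (d + 1)))
    cases d with
    | zero =>
      have a' := mul_nonneg (by linarith : 0 ≤ 1 - m) (sub_nonneg.2 (ih 0))
      simp only [heat_succ, heat_zero_right, zero_add] at *
      linarith
    | succ d =>
      have c := mul_nonneg h0 (sub_nonneg.2 (ih d))
      simp only [heat_succ] at *
      linarith

lemma heat_nonneg (h0 : 0 ≤ m) (h1 : m ≤ 1 / 2) (t d : ℕ) : 0 ≤ heat m t d := by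
  induction d with
  | zero => simp
  | succ d ih => exact ih.trans (heat_mono h0 h1 t d)

lemma heat_anti (h0 : 0 ≤ m) (h1 : m ≤ 1 / 2) (t d : ℕ) : heat m (t + 1) d ≤ heat m t d := by
  cases d with
  | zero => simp
  | succ d =>
    have := mul_nonpos_of_nonneg_of_nonpos h0 (heat_concave h0 h1 t d)
    rw [heat_succ]; linarith

lemma heat_le_one (h0 : 0 ≤ m) (h1 : m ≤ 1 / 2) (t d : ℕ) : heat m t d ≤ 1 := by
  induction t with
  | zero => cases d <;> norm_num [heat_zero_left]
  | succ t ih => exact (heat_anti h0 h1 t d).trans ih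

lemma heat_two_le (h0 : 0 ≤ m) (h1 : m ≤ 1 / 2) (t : ℕ) : heat m t 2 ≤ 2 * heat m t 1 := by
  have := heat_concave h0 h1 t 0
  simp only [heat_zero_right, zero_add] at this
  linarith

/-- The total of the values at `1` is sublinear in time. -/
lemma sum_heat_one_le (h0 : 0 < m) (h1 : m ≤ 1 / 2) (T R : ℕ) :
    R * ∑ t ∈ Finset.range T, heat m t 1 ≤ T + R ^ 2 / (2 * m) := by
  -- Summing the equation over time telescopes: m times the second difference of W is `heat m T`
  -- minus its initial value, hence at least -1. So W lies above a parabola of initial slope W 1,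
  -- whereas W R ≤ T.
  set W : ℕ → ℝ := fun d => ∑ t ∈ Finset.range T, heat m t d with hW
  have hW0 : W 0 = 0 := by simp [hW]
  have hΔ : ∀ d, -(1 / m) ≤ W (d + 2) - 2 * W (d + 1) + W d := by
    intro d
    have h : m * (W (d + 2) - 2 * W (d + 1) + W d) = heat m T (d + 1) - heat m 0 (d + 1) := by
      rw [← Finset.sum_range_sub (fun t => heat m t (d + 1))]
      simp only [hW, heat_succ, add_sub_cancel_left, ← Finset.mul_sum, Finset.sum_add_distrib,
        Finset.sum_sub_distrib]
    have h2 := heat_nonneg h0.le h1 T (d + 1)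
    rw [heat_zero_left] at h
    rw [neg_le_iff_add_nonneg, ← mul_nonneg_iff_of_pos_left h0, mul_add, h]
    field_simp
    linarith
  have hslope : ∀ d : ℕ, W 1 - d / m ≤ W (d + 1) - W d := by
    intro d
    induction d with
    | zero => simp [hW0]
    | succ d ih =>
      have := hΔ d
      push_cast
      rw [add_div]
      linarith
  have hlow : ∀ d : ℕ, d * W 1 - d ^ 2 / (2 * m) ≤ W d := by
    intro d
    induction d with
    | zero => simp [hW0]
    | succ d ih =>
      have h := hslope d
      have e : (((d + 1 : ℕ) : ℝ)) ^ 2 / (2 * m) = (d : ℝ) ^ 2 / (2 * m) + d / m + 1 / (2 * m) := by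
        push_cast; field_simp; ring
      have : 0 ≤ 1 / (2 * m) := by positivity
      rw [e]
      push_cast
      linarith
  have hT : W R ≤ T := by
    calc W R ≤ ∑ t ∈ Finset.range T, (1 : ℝ) :=
          Finset.sum_le_sum fun t _ => heat_le_one h0.le h1 t R
      _ = T := by simp
  have := hlow R
  show R * W 1 ≤ _
  linarith

/-- Values decrease in time, so the last one is at most the time average. Taking R of order √(mt)
gives decay of order 1/√(mt). -/
lemma heat_one_le (h0 : 0 < m) (h1 : m ≤ 1 / 2) (t R : ℕ) :
    R * ((t + 1) * heat m t 1) ≤ (t + 1) + R ^ 2 / (2 * m) := by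
  have h := sum_heat_one_le h0 h1 (t + 1) R
  have h2 : (t + 1) * heat m t 1 ≤ ∑ s ∈ Finset.range (t + 1), heat m s 1 := by
    calc (t + 1) * heat m t 1 = ∑ s ∈ Finset.range (t + 1), heat m t 1 := by simp
      _ ≤ _ := Finset.sum_le_sum fun s hs =>
        antitone_nat_of_succ_le (f := fun s => heat m s 1) (fun s => heat_anti h0.le h1 s 1)
          (by simpa [Nat.lt_succ_iff] using hs)
  push_cast at h
  exact (mul_le_mul_of_nonneg_left h2 (Nat.cast_nonneg R)).trans h

end Heat

/-! ### Contraction of moduli of continuity. -/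

/-- One step of the walk under a modulus of continuity: the coupling can be rearranged so that the
distance decreases with probability at least `m`. -/
lemma IsCoupling.avg_sub_avg_le (hd : ∀ x, 0 < G.degree x) (hconn : G.Connected)
    {w : ℕ → ℝ} (hmono : ∀ k, w k ≤ w (k + 1))
    (hconc : ∀ k, w (k + 2) - 2 * w (k + 1) + w k ≤ 0) {u : V → ℝ}
    (hu : ∀ a b, u b - u a ≤ w (G.dist a b)) {m : ℝ} (hm : ∀ x, m ≤ 1 / (2 * G.degree x))
    {x y x' : V} {d : ℕ} (hxy : G.dist x y = d + 1) (hadj : G.Adj x x') (hx' : G.dist x' y = d)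
    {ε : ℝ} {c : V → V → ℝ} (hc : IsCoupling G x y (d + 1 + ε) c) :
    avg G u y - avg G u x ≤
      w (d + 1) + m * (w (d + 2) - 2 * w (d + 1) + w d) + (w (d + 2) - w (d + 1)) * ε := by
  classical
  set A := closedNbhd G x with hA
  set B := closedNbhd G y with hB
  -- s is the slope of the supporting line L of w at d + 1, taken from the right; κ is the size of
  -- the kink there. By concavity w ≤ L at every distance, and w ≤ L - κ at distances at most d.
  -- Only the affine L is averaged against the coupling cost.
  set s := w (d + 2) - w (d + 1) with hs
  have hs0 : 0 ≤ s := sub_nonneg.2 (hmono _)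
  set κ := -(w (d + 2) - 2 * w (d + 1) + w d) with hκ
  have hκ0 : 0 ≤ κ := neg_nonneg.2 (hconc d)
  have hslope : Antitone fun k => w (k + 1) - w k :=
    antitone_nat_of_succ_le fun k => by have := hconc k; linarith
  -- the tangent line bounds
  have hup : ∀ j : ℕ, w (d + 1 + j) ≤ w (d + 1) + s * j := by
    intro j
    induction j with
    | zero => simp
    | succ j ih =>
      have := hslope (show d + 1 ≤ d + 1 + j by omega)
      simp only at this
      rw [show d + 1 + (j + 1) = d + 1 + j + 1 by ring]
      push_cast
      linarith
  have hdown : ∀ j k : ℕ, k + j = d → w k ≤ w (d + 1) + s * ((k : ℝ) - (d + 1)) - κ := by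
    intro j
    induction j with
    | zero =>
      rintro k rfl
      simp only [hκ, hs, add_zero]
      linarith
    | succ j ih =>
      intro k hk
      have h1 := ih (k + 1) (by omega)
      have h2 := hslope (show k ≤ d + 1 by omega)
      simp only at h2
      push_cast at h1
      have : s ≤ w (k + 1) - w k := h2
      linarith
  set L : V → V → ℝ := fun a b => w (d + 1) + s * ((G.dist a b : ℝ) - (d + 1)) with hL
  have hfar : ∀ a b, d + 1 ≤ G.dist a b → w (G.dist a b) ≤ L a b := by
    intro a b h
    obtain ⟨j, hj⟩ := Nat.exists_eq_add_of_le h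
    have := hup j
    simp only [hL, hj]
    push_cast
    linarith
  have hnear : ∀ a b, G.dist a b ≤ d → w (G.dist a b) ≤ L a b - κ := by
    intro a b h
    exact hdown (d - G.dist a b) _ (by omega)
  set e : V → V → ℝ := fun a b => u b - u a - L a b with he
  have he0 : ∀ a b, e a b ≤ 0 := by
    intro a b
    have := hu a b
    rcases le_or_gt (d + 1) (G.dist a b) with h | h
    · have := hfar a b h; simp only [he]; linarith
    · have := hnear a b (by omega); simp only [he]; linarith
  have hex'y : e x' y ≤ -κ := by
    have h1 := hu x' y
    have h2 := hnear x' y hx'.le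
    simp only [he]; linarith
  -- If x' and b are far apart, swap partners: compare x' with y at distance d and x with b at
  -- distance at most d + 2. The two increments together then fall short of the two values of L by
  -- κ.
  have hpair : ∀ b ∈ B, e x' b + e x y ≤ -κ := by
    intro b hb
    rcases le_or_gt (d + 1) (G.dist x' b) with h | h
    · have h1 := hu x' y
      have h2 := hu x b
      have h3 : w (G.dist x b) ≤ w (d + 2) := by
        refine monotone_nat_of_le_succ hmono ?_
        have h4 : G.dist x b ≤ G.dist x y + G.dist y b := hconn.dist_triangle
        have h5 : G.dist y b ≤ 1 := by
          rw [hB, mem_closedNbhd] at hb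
          rcases hb with rfl | hb
          · simp
          · rw [SimpleGraph.dist_eq_one_iff_adj.2 hb]
        omega
      have h6 : 0 ≤ s * ((G.dist x' b : ℝ) - (d + 1)) := by
        refine mul_nonneg hs0 (sub_nonneg.2 ?_)
        exact_mod_cast h
      rw [hx'] at h1
      simp only [he, hL, hxy]
      push_cast
      linarith
    · have h1 := hnear x' b (by omega)
      have h2 := hu x' b
      have h3 := he0 x y
      simp only [he] at h3 ⊢
      linarith
  have hxA : x ∈ A := by simp [hA]
  have hyB : y ∈ B := by simp [hB]
  have hx'A : x' ∈ A := by simp [hA, hadj]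
  have hne : x' ∈ A.erase x := by simp [hx'A, hadj.ne']
  -- the mass moved from `x'` away from `y` is at most the mass moved from `x` to `y`
  have hmass : ∑ b ∈ B.erase y, c x' b ≤ c x y := by
    have h1 : ∑ b ∈ B.erase y, c x' b ≤ ∑ a ∈ A.erase x, ∑ b ∈ B.erase y, c a b :=
      Finset.single_le_sum (f := fun a => ∑ b ∈ B.erase y, c a b)
        (fun a _ => Finset.sum_nonneg fun b _ => hc.nonneg a b) hne
    have h2 : ∀ a, ∑ b ∈ B.erase y, c a b = weight G x a - c a y := by
      intro a
      rw [← hc.left a, ← hB, ← Finset.add_sum_erase B _ hyB]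
      ring
    -- Laziness enters here: x and y are atoms of mass 1/2, so the mass outside row x and column y
    -- equals c x y.
    have h3 : ∑ a ∈ A.erase x, weight G x a = 1 / 2 := by
      have := sum_weight (hd x)
      rw [← hA, ← Finset.add_sum_erase A _ hxA, weight_self] at this
      linarith
    have h4 : ∑ a ∈ A.erase x, c a y = 1 / 2 - c x y := by
      have := hc.right y
      rw [← hA, ← Finset.add_sum_erase A _ hxA, weight_self] at this
      linarith
    simp only [h2] at h1 ⊢
    rw [Finset.sum_sub_distrib, h3, h4] at h1
    linarith
  have hrow : ∀ a, ∑ b ∈ B, c a b * e a b ≤ 0 := fun a =>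
    Finset.sum_nonpos fun b _ => mul_nonpos_of_nonneg_of_nonpos (hc.nonneg a b) (he0 a b)
  -- Each unit of mass in row x' gains κ: at (x', y) directly, elsewhere when paired with equal mass
  -- at (x, y). That row has mass 1/(2 deg x) ≥ m; all other entries contribute with the right sign.
  have hgain : ∑ a ∈ A, ∑ b ∈ B, c a b * e a b ≤ -κ * m := by
    have h1 : ∑ a ∈ A, ∑ b ∈ B, c a b * e a b
        ≤ ∑ b ∈ B, c x b * e x b + ∑ b ∈ B, c x' b * e x' b := by
      rw [← Finset.add_sum_erase A _ hxA, ← Finset.add_sum_erase (A.erase x) _ hne]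
      have : ∑ a ∈ (A.erase x).erase x', ∑ b ∈ B, c a b * e a b ≤ 0 :=
        Finset.sum_nonpos fun a _ => hrow a
      linarith
    have h2 : ∑ b ∈ B, c x b * e x b ≤ c x y * e x y := by
      rw [← Finset.add_sum_erase B _ hyB]
      have : ∑ b ∈ B.erase y, c x b * e x b ≤ 0 := Finset.sum_nonpos fun b _ =>
        mul_nonpos_of_nonneg_of_nonpos (hc.nonneg x b) (he0 x b)
      linarith
    have h3 : c x y * e x y ≤ ∑ b ∈ B.erase y, c x' b * e x y := by
      rw [← Finset.sum_mul]
      exact mul_le_mul_of_nonpos_right hmass (he0 x y)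
    have h4 : ∑ b ∈ B.erase y, c x' b * e x y + ∑ b ∈ B, c x' b * e x' b
        ≤ ∑ b ∈ B, c x' b * (-κ) := by
      rw [← Finset.add_sum_erase B (fun b => c x' b * e x' b) hyB,
        ← Finset.add_sum_erase B (fun b => c x' b * (-κ)) hyB, add_left_comm,
        ← Finset.sum_add_distrib]
      refine add_le_add (mul_le_mul_of_nonneg_left hex'y (hc.nonneg _ _))
        (Finset.sum_le_sum fun b hb => ?_)
      rw [← mul_add, add_comm (e x y)]
      exact mul_le_mul_of_nonneg_left (hpair b (Finset.mem_of_mem_erase hb)) (hc.nonneg _ _)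
    have h5 : ∑ b ∈ B, c x' b * (-κ) = -κ * (1 / (2 * G.degree x)) := by
      rw [← Finset.sum_mul, hc.left, weight_adj hadj, mul_comm]
    have h6 : -κ * (1 / (2 * G.degree x)) ≤ -κ * m :=
      mul_le_mul_of_nonpos_left (hm x) (by linarith)
    linarith
  have htot : ∑ a ∈ A, ∑ b ∈ B, c a b = 1 := by
    rw [← sum_weight (hd x)]
    exact Finset.sum_congr rfl fun a _ => hc.left a
  have hlin : ∑ a ∈ A, ∑ b ∈ B, c a b * L a b ≤ w (d + 1) + s * ε := by
    have h1 : ∑ a ∈ A, ∑ b ∈ B, c a b * L a b = (w (d + 1) - s * (d + 1)) * ∑ a ∈ A, ∑ b ∈ B, c a b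
        + s * ∑ a ∈ A, ∑ b ∈ B, c a b * (G.dist a b : ℝ) := by
      simp only [Finset.mul_sum, ← Finset.sum_add_distrib]
      refine Finset.sum_congr rfl fun a _ => Finset.sum_congr rfl fun b _ => ?_
      simp only [hL]; ring
    have := mul_le_mul_of_nonneg_left hc.cost hs0
    rw [h1, htot]
    linarith
  have hsplit : avg G u y - avg G u x
      = ∑ a ∈ A, ∑ b ∈ B, c a b * L a b + ∑ a ∈ A, ∑ b ∈ B, c a b * e a b := by
    have h1 : avg G u y = ∑ a ∈ A, ∑ b ∈ B, c a b * u b := by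
      rw [Finset.sum_comm, ← sum_weight_mul]
      exact Finset.sum_congr rfl fun b _ => by rw [← Finset.sum_mul, hc.right]
    have h2 : avg G u x = ∑ a ∈ A, ∑ b ∈ B, c a b * u a := by
      rw [← sum_weight_mul]
      exact Finset.sum_congr rfl fun a _ => by rw [← Finset.sum_mul, hc.left]
    rw [h1, h2]
    simp only [← Finset.sum_add_distrib, ← Finset.sum_sub_distrib]
    refine Finset.sum_congr rfl fun a _ => Finset.sum_congr rfl fun b _ => ?_
    simp only [he]; ring
  rw [hsplit]
  have : -κ * m = m * (w (d + 2) - 2 * w (d + 1) + w d) := by rw [hκ]; ring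
  linarith

/-- The heat equation on `ℕ` controls the modulus of continuity of the semigroup. -/
lemma iterate_avg_sub_le (hd : ∀ x, 0 < G.degree x) (hconn : G.Connected)
    (hG : HasNonnegOllivierRicci G) {m : ℝ} (h0 : 0 ≤ m) (h1 : m ≤ 1 / 2)
    (hm : ∀ x, m ≤ 1 / (2 * G.degree x)) {f : V → ℝ} (hf0 : ∀ x, 0 ≤ f x) (hf1 : ∀ x, f x ≤ 1)
    (t : ℕ) (x y : V) :
    ((avg G)^[t] f) y - ((avg G)^[t] f) x ≤ heat m t (G.dist x y) := by
  induction t generalizing x y with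
  | zero =>
    rcases hk : G.dist x y with _ | k
    · rw [hconn.dist_eq_zero_iff] at hk
      simp [hk]
    · have := hf0 x
      have := hf1 y
      simp only [Function.iterate_zero, id_eq, heat_zero_left]
      linarith
  | succ t ih =>
    rw [Function.iterate_succ_apply']
    rcases hk : G.dist x y with _ | d
    · rw [hconn.dist_eq_zero_iff] at hk
      simp [hk]
    · obtain ⟨x', hadj, hx'⟩ := exists_adj_dist hconn hk
      rw [heat_succ]
      set s := heat m t (d + 2) - heat m t (d + 1) with hs
      have hs0 : 0 ≤ s := sub_nonneg.2 (heat_mono h0 h1 t _)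
      refine le_of_forall_pos_le_add fun ε hε => ?_
      -- The slack costs s · ε/(s + 1) ≤ ε; the added 1 covers s = 0.
      obtain ⟨c, hc⟩ := exists_isCoupling hd hconn hG d hk (ε := ε / (s + 1)) (by positivity)
      refine (hc.avg_sub_avg_le hd hconn (heat_mono h0 h1 t) (heat_concave h0 h1 t) ih hm hk hadj
        hx').trans ?_
      gcongr
      rw [← hs, mul_div_assoc', div_le_iff₀ (by positivity)]
      nlinarith

/-! ### The t-step kernel, its reversibility and its regularity. -/

open Classical in
variable (G) in
/-- The `t`-step transition probabilities of the lazy simple random walk. -/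
noncomputable def kernel (t : ℕ) (x z : V) : ℝ := ((avg G)^[t] (Pi.single z 1)) x

lemma kernel_succ (t : ℕ) (x z : V) :
    kernel G (t + 1) x z = avg G (fun y => kernel G t y z) x := by
  rw [kernel, Function.iterate_succ_apply']; rfl

lemma avg_nonneg {f : V → ℝ} (hf : ∀ x, 0 ≤ f x) (x : V) : 0 ≤ avg G f x :=
  add_nonneg (div_nonneg (hf x) zero_le_two)
    (div_nonneg (Finset.sum_nonneg fun y _ => hf y) (by positivity))

lemma kernel_nonneg (t : ℕ) (x z : V) : 0 ≤ kernel G t x z := by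
  classical
  induction t generalizing x with
  | zero => rw [kernel, Function.iterate_zero, id_eq, Pi.single_apply]; split_ifs <;> norm_num
  | succ t ih => rw [kernel_succ]; exact avg_nonneg ih x

open Classical in
lemma sum_kernel_mul (S : Finset V) (f : V → ℝ) (t : ℕ) (x : V) :
    ∑ z ∈ S, kernel G t x z * f z = ((avg G)^[t] fun v => if v ∈ S then f v else 0) x := by
  induction t generalizing x with
  | zero => simp [kernel, Pi.single_apply]
  | succ t ih =>
    rw [Function.iterate_succ_apply', ← sum_weight_mul]
    simp only [kernel_succ, ← ih, ← sum_weight_mul, Finset.sum_mul, Finset.mul_sum]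
    rw [Finset.sum_comm]
    exact Finset.sum_congr rfl fun a _ => Finset.sum_congr rfl fun z _ => by ring

lemma sum_kernel_le_one (hd : ∀ x, 0 < G.degree x) (S : Finset V) (t : ℕ) (x : V) :
    ∑ z ∈ S, kernel G t x z ≤ 1 := by
  induction t generalizing x with
  | zero =>
    classical
    simp only [kernel, Function.iterate_zero, id_eq, Finset.sum_pi_single]
    split_ifs <;> norm_num
  | succ t ih =>
    have h : ∑ z ∈ S, kernel G (t + 1) x z = avg G (fun y => ∑ z ∈ S, kernel G t y z) x := by
      simp only [kernel_succ, ← sum_weight_mul, Finset.mul_sum]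
      rw [Finset.sum_comm]
    rw [h]
    exact (avg_mono ih x).trans (avg_const (hd x) 1).le

/-- The walk reaches finitely many vertices in t steps, so conservation of mass needs no infinite
sums. -/
lemma exists_sum_kernel_eq_one (hd : ∀ x, 0 < G.degree x) (t : ℕ) (x : V) :
    ∃ Z : Finset V, ∀ S, Z ⊆ S → ∑ z ∈ S, kernel G t x z = 1 := by
  classical
  induction t generalizing x with
  | zero =>
    refine ⟨{x}, fun S hS => ?_⟩
    have hx : x ∈ S := hS (Finset.mem_singleton_self x)
    simp [kernel, Finset.sum_pi_single, hx]
  | succ t ih =>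
    choose Z hZ using ih
    refine ⟨(closedNbhd G x).biUnion Z, fun S hS => ?_⟩
    have h : ∀ a ∈ closedNbhd G x, ∑ z ∈ S, kernel G t a z = 1 := fun a ha =>
      hZ a S ((Finset.subset_biUnion_of_mem Z ha).trans hS)
    simp only [kernel_succ, ← sum_weight_mul]
    rw [Finset.sum_comm, ← sum_weight (hd x)]
    refine Finset.sum_congr rfl fun a ha => ?_
    rw [← Finset.mul_sum, h a ha, mul_one]

/-- Here the last step of the walk is split off, whereas the definition splits off the first;
reversibility comes from comparing the two. -/
lemma kernel_succ' (t : ℕ) (x z : V) :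
    kernel G (t + 1) x z = kernel G t x z / 2
      + ∑ y ∈ G.neighborFinset z, kernel G t x y / (2 * G.degree y) := by
  classical
  have h : avg G (Pi.single z 1) = fun v => if v ∈ closedNbhd G z then weight G v z else 0 := by
    funext v
    rw [← sum_weight_mul]
    simp only [Pi.single_apply, mul_ite, mul_one, mul_zero, Finset.sum_ite_eq', mem_closedNbhd,
      G.adj_comm z, eq_comm (a := z)]
  rw [kernel, Function.iterate_succ_apply, h, ← sum_kernel_mul, closedNbhd, Finset.sum_cons,
    weight_self]
  congr 1
  · ring
  · refine Finset.sum_congr rfl fun y hy => ?_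
    rw [weight_adj (by simpa [G.adj_comm] using hy)]
    ring

/-- Reversibility of the walk. -/
lemma degree_mul_kernel (hd : ∀ x, 0 < G.degree x) (t : ℕ) (x z : V) :
    G.degree x * kernel G t x z = G.degree z * kernel G t z x := by
  classical
  induction t generalizing x z with
  | zero =>
    simp only [kernel, Function.iterate_zero, id_eq, Pi.single_apply]
    by_cases h : x = z
    · subst h; rfl
    · simp [h, Ne.symm h]
  | succ t ih =>
    have hne : ∀ v, (G.degree v : ℝ) ≠ 0 := fun v => by have := hd v; positivity
    have h : ∑ y ∈ G.neighborFinset x, kernel G t y z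
        = 2 * G.degree z * ∑ y ∈ G.neighborFinset x, kernel G t z y / (2 * G.degree y) := by
      rw [Finset.mul_sum]
      refine Finset.sum_congr rfl fun y _ => ?_
      have := hne y
      field_simp
      rw [mul_comm, ih, mul_comm]
    have := hne x
    rw [kernel_succ, kernel_succ', avg, h, mul_add, mul_add, ← mul_div_assoc, ih x z,
      ← mul_div_assoc]
    refine congrArg₂ _ (by ring) ?_
    rw [div_eq_iff (by positivity)]
    ring

/-- The modulus bound is applied to indicator functions of the sets where one kernel dominates the
other. -/
lemma sum_abs_kernel_sub_le (hd : ∀ x, 0 < G.degree x) (hconn : G.Connected)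
    (hG : HasNonnegOllivierRicci G) {m : ℝ} (h0 : 0 ≤ m) (h1 : m ≤ 1 / 2)
    (hm : ∀ x, m ≤ 1 / (2 * G.degree x)) (t : ℕ) (x y : V) (S : Finset V) :
    ∑ z ∈ S, |kernel G t x z - kernel G t y z| ≤ 2 * heat m t (G.dist x y) := by
  classical
  have key : ∀ (x y : V) (S : Finset V),
      ∑ z ∈ S, (kernel G t y z - kernel G t x z) ≤ heat m t (G.dist x y) := by
    intro x y S
    have h := iterate_avg_sub_le hd hconn hG h0 h1 hm (f := fun v => if v ∈ S then 1 else 0)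
      (fun v => by split_ifs <;> norm_num) (fun v => by split_ifs <;> norm_num) t x y
    rw [← sum_kernel_mul, ← sum_kernel_mul] at h
    simpa [Finset.sum_sub_distrib] using h
  rw [← Finset.sum_filter_add_sum_filter_not S (fun z => kernel G t x z ≤ kernel G t y z)]
  have a := key x y (S.filter fun z => kernel G t x z ≤ kernel G t y z)
  have b := key y x (S.filter fun z => ¬ kernel G t x z ≤ kernel G t y z)
  rw [G.dist_comm] at b
  rw [two_mul]
  refine add_le_add (le_trans (Finset.sum_le_sum fun z hz => ?_) a)
    (le_trans (Finset.sum_le_sum fun z hz => ?_) b)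
  · rw [Finset.mem_filter] at hz
    rw [abs_sub_comm, abs_of_nonneg (sub_nonneg.2 hz.2)]
  · rw [Finset.mem_filter, not_le] at hz
    rw [abs_of_pos (sub_pos.2 hz.2)]

/-! ### Entropy: sublinear growth and one-step production. -/

section Entropy

open Real

/-- The entropy of a mixture exceeds the mean entropy by at most the sum of the deviations. -/
lemma negMulLog_sum_le {ι : Type*} (A : Finset ι) {p a : ι → ℝ} (hp : ∀ i ∈ A, 0 ≤ p i)
    (hsum : ∑ i ∈ A, p i = 1) (ha : ∀ i ∈ A, 0 ≤ a i) {b : ℝ} (hb : b = ∑ i ∈ A, p i * a i) :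
    negMulLog b ≤ ∑ i ∈ A, p i * negMulLog (a i) + ∑ i ∈ A, |a i - b| := by
  -- From log r ≤ r - 1, the left side is at most p(a - b) + p(a - b)²/b, and p a ≤ b forces p|a -
  -- b| ≤ b. The terms p(a - b) sum to zero.
  have hpt : ∀ i ∈ A, p i * a i * (log (a i) - log b) ≤ p i * (a i - b) + |a i - b| := by
    intro i hi
    have hpi := hp i hi
    have hai := ha i hi
    have hp1 : p i ≤ 1 := hsum ▸ Finset.single_le_sum hp hi
    have hpa : p i * a i ≤ b :=
      hb ▸ Finset.single_le_sum (f := fun i => p i * a i) (fun j hj => mul_nonneg (hp j hj) (ha j hj)) hi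
    have hb0 : 0 ≤ b := (mul_nonneg hpi hai).trans hpa
    rcases hai.eq_or_lt with h | h
    · rw [← h, zero_sub, abs_neg, abs_of_nonneg hb0]
      nlinarith
    rcases hpi.eq_or_lt with h' | h'
    · simp [← h']
    have hbpos : 0 < b := (mul_pos h' h).trans_le hpa
    have hlog : log (a i) - log b ≤ (a i - b) / b := by
      rw [← log_div h.ne' hbpos.ne', sub_div, div_self hbpos.ne']
      exact log_le_sub_one_of_pos (div_pos h hbpos)
    have h1 : p i * |a i - b| ≤ b := by
      rcases abs_cases (a i - b) with ⟨e, _⟩ | ⟨e, _⟩ <;> rw [e] <;> nlinarith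
    calc p i * a i * (log (a i) - log b) ≤ p i * a i * ((a i - b) / b) := by gcongr
      _ = p i * (a i - b) + p i * |a i - b| * |a i - b| / b := by
        rw [mul_assoc (p i) |a i - b|, abs_mul_abs_self]; field_simp; ring
      _ ≤ p i * (a i - b) + b * |a i - b| / b := by gcongr
      _ = _ := by rw [mul_div_cancel_left₀ _ hbpos.ne']
  have := Finset.sum_le_sum hpt
  rw [Finset.sum_add_distrib] at this
  simp only [mul_sub, Finset.sum_sub_distrib, ← Finset.sum_mul, hsum, ← hb] at this
  simp only [negMulLog, mul_neg, neg_mul, Finset.sum_neg_distrib, ← mul_assoc]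
  linarith

/-- The law p_{t+1}(x,·) is a mixture of at most M + 1 laws p_t(y,·). Their starting points are
within distance 2, so each deviates from the mixture by at most 2 `heat m t 2` ≤ 4 `heat m t 1` in
ℓ¹. -/
lemma sum_negMulLog_kernel_le (hd : ∀ x, 0 < G.degree x) (hconn : G.Connected)
    (hG : HasNonnegOllivierRicci G) {m M : ℝ} (h0 : 0 ≤ m) (h1 : m ≤ 1 / 2)
    (hm : ∀ x, m ≤ 1 / (2 * G.degree x)) (hM : ∀ x, (G.degree x : ℝ) ≤ M) (S : Finset V)
    (t : ℕ) (x : V) :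
    ∑ z ∈ S, negMulLog (kernel G t x z)
      ≤ 4 * (M + 1) * ∑ s ∈ Finset.range t, heat m s 1 := by
  have hM0 : 0 ≤ M := (Nat.cast_nonneg _).trans (hM x)
  induction t generalizing x with
  | zero =>
    classical
    refine (Finset.sum_nonpos fun z _ => ?_).trans (by simp)
    simp only [kernel, Function.iterate_zero, id_eq, Pi.single_apply]
    split_ifs <;> simp
  | succ t ih =>
    have hb : ∀ z, kernel G (t + 1) x z = ∑ y ∈ closedNbhd G x, weight G x y * kernel G t y z :=
      fun z => by rw [kernel_succ, sum_weight_mul]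
    have hstep : ∑ z ∈ S, negMulLog (kernel G (t + 1) x z)
        ≤ ∑ z ∈ S, (∑ y ∈ closedNbhd G x, weight G x y * negMulLog (kernel G t y z)
          + ∑ y ∈ closedNbhd G x, |kernel G t y z - kernel G (t + 1) x z|) :=
      Finset.sum_le_sum fun z _ => negMulLog_sum_le _ (fun y _ => weight_nonneg x y)
        (sum_weight (hd x)) (fun y _ => kernel_nonneg t y z) (hb z)
    have hdist : ∀ y ∈ closedNbhd G x, ∀ y' ∈ closedNbhd G x, G.dist y y' ≤ 2 := by
      have h : ∀ y ∈ closedNbhd G x, G.dist x y ≤ 1 := by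
        intro y hy
        rw [mem_closedNbhd] at hy
        rcases hy with rfl | hy
        · simp
        · rw [SimpleGraph.dist_eq_one_iff_adj.2 hy]
      intro y hy y' hy'
      have h1 : G.dist y y' ≤ G.dist y x + G.dist x y' := hconn.dist_triangle
      have h2 := h y hy
      have h3 := h y' hy'
      rw [G.dist_comm] at h2
      omega
    have hdev : ∀ y ∈ closedNbhd G x,
        ∑ z ∈ S, |kernel G t y z - kernel G (t + 1) x z| ≤ 4 * heat m t 1 := by
      intro y hy
      calc ∑ z ∈ S, |kernel G t y z - kernel G (t + 1) x z|
          ≤ ∑ z ∈ S, ∑ y' ∈ closedNbhd G x,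
              weight G x y' * |kernel G t y z - kernel G t y' z| := by
            refine Finset.sum_le_sum fun z _ => ?_
            have : kernel G t y z - kernel G (t + 1) x z
                = ∑ y' ∈ closedNbhd G x, weight G x y' * (kernel G t y z - kernel G t y' z) := by
              simp only [mul_sub, Finset.sum_sub_distrib, ← Finset.sum_mul, sum_weight (hd x),
                one_mul, hb]
            rw [this]
            refine (Finset.abs_sum_le_sum_abs _ _).trans_eq (Finset.sum_congr rfl fun y' _ => ?_)
            rw [abs_mul, abs_of_nonneg (weight_nonneg x y')]
        _ = ∑ y' ∈ closedNbhd G x,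
              weight G x y' * ∑ z ∈ S, |kernel G t y z - kernel G t y' z| := by
            rw [Finset.sum_comm]; simp only [Finset.mul_sum]
        _ ≤ ∑ y' ∈ closedNbhd G x, weight G x y' * (4 * heat m t 1) := by
            refine Finset.sum_le_sum fun y' hy' =>
              mul_le_mul_of_nonneg_left ?_ (weight_nonneg x y')
            have a := sum_abs_kernel_sub_le hd hconn hG h0 h1 hm t y y' S
            have b := monotone_nat_of_le_succ (heat_mono h0 h1 t) (hdist y hy y' hy')
            have c := heat_two_le h0 h1 t
            linarith
        _ = 4 * heat m t 1 := by rw [← Finset.sum_mul, sum_weight (hd x), one_mul]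
    have hcard : ((closedNbhd G x).card : ℝ) ≤ M + 1 := by
      rw [closedNbhd, Finset.card_cons, SimpleGraph.card_neighborFinset_eq_degree]
      push_cast
      linarith [hM x]
    have hheat := heat_nonneg h0 h1 t 1
    have hfirst : ∑ z ∈ S, ∑ y ∈ closedNbhd G x, weight G x y * negMulLog (kernel G t y z)
        ≤ 4 * (M + 1) * ∑ s ∈ Finset.range t, heat m s 1 := by
      rw [Finset.sum_comm]
      simp only [← Finset.mul_sum]
      rw [sum_weight_mul (fun y => ∑ z ∈ S, negMulLog (kernel G t y z))]
      exact (avg_mono ih x).trans (avg_const (hd x) _).le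
    have hsecond : ∑ z ∈ S, ∑ y ∈ closedNbhd G x, |kernel G t y z - kernel G (t + 1) x z|
        ≤ (M + 1) * (4 * heat m t 1) := by
      rw [Finset.sum_comm]
      calc _ ≤ ∑ y ∈ closedNbhd G x, 4 * heat m t 1 := Finset.sum_le_sum hdev
        _ = (closedNbhd G x).card * (4 * heat m t 1) := by simp
        _ ≤ _ := by gcongr
    rw [Finset.sum_add_distrib] at hstep
    rw [Finset.sum_range_succ]
    linarith

/-- A quantitative strict convexity of `u log u`. -/
lemma two_mul_abs_sub_le {a b l : ℝ} (ha : 0 ≤ a) (hb : 0 ≤ b) (hab : b = 0 → a = 0) :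
    2 * l * |a - b| - 2 * l ^ 2 * (a + b) ≤ -negMulLog a - a * log b - a + b := by
  -- Relative entropy dominates squared Hellinger distance; factoring a - b through square roots and
  -- applying AM-GM with parameter l then gives the claim.
  have hsq : (√a - √b) ^ 2 ≤ -negMulLog a - a * log b - a + b := by
    rcases ha.eq_or_lt with rfl | ha'
    · simp [sq_sqrt hb]
    have hb' : 0 < b := hb.lt_of_ne fun h => ha'.ne' (hab h.symm)
    have h1 : log (√b / √a) ≤ √b / √a - 1 := log_le_sub_one_of_pos (by positivity)
    rw [log_div (by positivity) (by positivity), log_sqrt hb, log_sqrt ha] at h1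
    have h2 := mul_le_mul_of_nonneg_left h1 (mul_nonneg zero_le_two ha)
    have h3 : a * (√b / √a) = √a * √b := by
      rw [mul_div_assoc', div_eq_iff (by positivity), mul_right_comm, mul_self_sqrt ha]
    have h4 : 2 * a * (√b / √a - 1) = 2 * (√a * √b) - 2 * a := by rw [← h3]; ring
    rw [h4] at h2
    rw [sub_sq, sq_sqrt ha, sq_sqrt hb, negMulLog]
    linarith
  refine le_trans ?_ hsq
  have h1 : |a - b| = |√a - √b| * (√a + √b) := by
    rw [← abs_of_nonneg (add_nonneg (sqrt_nonneg a) (sqrt_nonneg b)), ← abs_mul]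
    congr 1
    nlinarith [sq_sqrt ha, sq_sqrt hb]
  have h2 : (√a + √b) ^ 2 ≤ 2 * (a + b) := by
    nlinarith [sq_sqrt ha, sq_sqrt hb, sq_nonneg (√a - √b)]
  rw [h1]
  nlinarith [sq_nonneg (|√a - √b| - l * (√a + √b)), sq_abs (√a - √b),
    mul_le_mul_of_nonneg_left h2 (sq_nonneg l)]

/-- The entropy produced by one step of the walk controls the gradient. -/
lemma gradient_le_negMulLog_avg (hd : ∀ x, 0 < G.degree x) {F : V → ℝ} (hF : ∀ x, 0 ≤ F x)
    (l : ℝ) (hl : 0 ≤ l) (x : V) :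
    l * ((∑ y ∈ G.neighborFinset x, |F x - F y|) / G.degree x) - 4 * l ^ 2 * avg G F x
      ≤ negMulLog (avg G F x) - avg G (fun y => negMulLog (F y)) x := by
  set b := avg G F x with hb
  have hb0 : 0 ≤ b := avg_nonneg hF x
  have hdx : (0 : ℝ) < G.degree x := by exact_mod_cast hd x
  have hz : ∀ y ∈ closedNbhd G x, b = 0 → F y = 0 := by
    intro y hy h
    rw [hb, ← sum_weight_mul, Finset.sum_eq_zero_iff_of_nonneg
      fun a _ => mul_nonneg (weight_nonneg x a) (hF a)] at h
    exact (mul_eq_zero.1 (h y hy)).resolve_left (weight_pos hd hy).ne'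
  have hsum := Finset.sum_le_sum fun (y : V) (hy : y ∈ closedNbhd G x) =>
    mul_le_mul_of_nonneg_left (two_mul_abs_sub_le (l := l) (hF y) hb0 (hz y hy))
      (weight_nonneg (G := G) x y)
  have hR : ∑ y ∈ closedNbhd G x, weight G x y * (-negMulLog (F y) - F y * log b - F y + b)
      = negMulLog b - avg G (fun y => negMulLog (F y)) x := by
    have h1 := sum_weight_mul (G := G) F x
    have h2 := sum_weight_mul (G := G) (fun y => negMulLog (F y)) x
    have h3 := sum_weight (hd x)
    have h4 : ∀ y, weight G x y * (-negMulLog (F y) - F y * log b - F y + b)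
      = -(weight G x y * negMulLog (F y)) - weight G x y * F y * log b - weight G x y * F y
        + weight G x y * b := fun y => by ring
    simp only [h4, Finset.sum_add_distrib, Finset.sum_sub_distrib, Finset.sum_neg_distrib,
      ← Finset.sum_mul, h1, h2, h3, ← hb]
    simp only [negMulLog]; ring
  have hL : ∑ y ∈ closedNbhd G x, weight G x y * (2 * l * |F y - b| - 2 * l ^ 2 * (F y + b))
      = 2 * l * ∑ y ∈ closedNbhd G x, weight G x y * |F y - b| - 4 * l ^ 2 * b := by
    have h1 := sum_weight_mul (G := G) F x
    have h3 := sum_weight (hd x)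
    have h4 : ∀ y, weight G x y * (2 * l * |F y - b| - 2 * l ^ 2 * (F y + b))
      = 2 * l * (weight G x y * |F y - b|) - 2 * l ^ 2 * (weight G x y * F y)
        - 2 * l ^ 2 * b * weight G x y := fun y => by ring
    simp only [h4, Finset.sum_sub_distrib, ← Finset.mul_sum, h1, h3, ← hb]
    ring
  -- Triangle inequality through the mean b. Since the weights are 1/2 and 1/(2 deg x), the two
  -- resulting terms form exactly twice the weighted deviation.
  have hgrad : (∑ y ∈ G.neighborFinset x, |F x - F y|) / G.degree x
      ≤ 2 * ∑ y ∈ closedNbhd G x, weight G x y * |F y - b| := by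
    rw [sum_weight_mul (fun y => |F y - b|), avg]
    have : ∑ y ∈ G.neighborFinset x, |F x - F y|
        ≤ G.degree x * |F x - b| + ∑ y ∈ G.neighborFinset x, |F y - b| := by
      rw [← SimpleGraph.card_neighborFinset_eq_degree, ← nsmul_eq_mul, ← Finset.sum_const,
        ← Finset.sum_add_distrib]
      refine Finset.sum_le_sum fun y _ => ?_
      rw [abs_sub_comm (F y)]
      exact abs_sub_le _ _ _
    rw [div_le_iff₀ hdx]
    refine this.trans_eq ?_
    field_simp
  rw [hR, hL] at hsum
  have := mul_le_mul_of_nonneg_left hgrad hl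
  linarith

end Entropy

/-! ### Balls and the invariant measure. -/

open Classical in
variable (G) in
/-- The ball of radius `t` around `z`. -/
noncomputable def ball (z : V) : ℕ → Finset V
  | 0 => {z}
  | t + 1 => (ball z t).biUnion (closedNbhd G)

lemma closedNbhd_subset_ball {z x : V} {t : ℕ} (hx : x ∈ ball G z t) :
    closedNbhd G x ⊆ ball G z (t + 1) := by
  classical
  exact Finset.subset_biUnion_of_mem (closedNbhd G) hx

lemma ball_mono (z : V) : Monotone (ball G z) :=
  monotone_nat_of_le_succ fun _ _ hx => closedNbhd_subset_ball hx (by simp)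

lemma mem_ball_of_kernel_ne_zero {t : ℕ} {x z : V} (h : kernel G t x z ≠ 0) :
    x ∈ ball G z t := by
  classical
  induction t generalizing x with
  | zero =>
    simp only [kernel, Function.iterate_zero, id_eq, Pi.single_apply, ne_eq, ite_eq_right_iff,
      one_ne_zero, imp_false, not_not] at h
    simp [ball, h]
  | succ t ih =>
    rw [kernel_succ, ← sum_weight_mul] at h
    obtain ⟨y, hy, hne⟩ := Finset.exists_ne_zero_of_sum_ne_zero h
    refine closedNbhd_subset_ball (ih (right_ne_zero_of_mul hne)) ?_
    rw [mem_closedNbhd] at hy ⊢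
    exact hy.imp Eq.symm G.adj_symm

lemma card_ball_le {M : ℝ} (hM : ∀ x, (G.degree x : ℝ) ≤ M) (z : V) (t : ℕ) :
    ((ball G z t).card : ℝ) ≤ (M + 1) ^ t := by
  classical
  have hM0 : 0 ≤ M := (Nat.cast_nonneg _).trans (hM z)
  induction t with
  | zero => simp [ball]
  | succ t ih =>
    calc ((ball G z (t + 1)).card : ℝ)
        ≤ ((∑ x ∈ ball G z t, (closedNbhd G x).card : ℕ) : ℝ) := by
          exact_mod_cast Finset.card_biUnion_le
      _ ≤ ∑ x ∈ ball G z t, (M + 1) := by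
          push_cast
          refine Finset.sum_le_sum fun x _ => ?_
          rw [closedNbhd, Finset.card_cons, SimpleGraph.card_neighborFinset_eq_degree]
          push_cast
          linarith [hM x]
      _ = (ball G z t).card * (M + 1) := by rw [Finset.sum_const, nsmul_eq_mul]
      _ ≤ (M + 1) ^ (t + 1) := by rw [pow_succ]; gcongr

/-- The degree is an invariant measure. -/
lemma sum_degree_mul_avg (hd : ∀ x, 0 < G.degree x) {f : V → ℝ} {S : Finset V}
    (hS : ∀ x, f x ≠ 0 → closedNbhd G x ⊆ S) :
    ∑ x ∈ S, G.degree x * avg G f x = ∑ x ∈ S, G.degree x * f x := by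
  classical
  have hzero : ∀ x, x ∉ S → f x = 0 := fun x hx => by
    by_contra h
    exact hx (hS x h (by simp))
  have h1 : ∀ x, G.degree x * avg G f x
      = G.degree x * f x / 2 + (∑ y ∈ G.neighborFinset x, f y) / 2 := by
    intro x
    have : (G.degree x : ℝ) ≠ 0 := by have := hd x; positivity
    rw [avg]; field_simp
  have h2 : ∑ x ∈ S, ∑ y ∈ G.neighborFinset x, f y = ∑ x ∈ S, G.degree x * f x := by
    have h3 : ∀ x, ∑ y ∈ G.neighborFinset x, f y = ∑ y ∈ S, if G.Adj x y then f y else 0 := by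
      intro x
      rw [← Finset.sum_filter]
      refine (Finset.sum_subset_zero_on_sdiff (fun y hy => ?_) (fun y hy => ?_)
        (fun _ _ => rfl)).symm
      · simpa using (Finset.mem_filter.1 hy).2
      · simp only [Finset.mem_sdiff, SimpleGraph.mem_neighborFinset, Finset.mem_filter,
          not_and] at hy
        exact hzero y fun h => hy.2 h hy.1
    simp only [h3]
    rw [Finset.sum_comm]
    refine Finset.sum_congr rfl fun y _ => ?_
    by_cases hy : f y = 0
    · simp [hy]
    · rw [← Finset.sum_filter, Finset.sum_const, nsmul_eq_mul,
        ← SimpleGraph.card_neighborFinset_eq_degree]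
      congr 3
      ext x
      simp only [Finset.mem_filter, SimpleGraph.mem_neighborFinset, G.adj_comm y]
      exact ⟨fun h => h.2, fun h => ⟨hS y hy (by simp [G.adj_comm y, h]), h⟩⟩
  simp only [h1, Finset.sum_add_distrib, ← Finset.sum_div, h2]
  ring

lemma sum_degree_mul_kernel (hd : ∀ x, 0 < G.degree x) (o : V) {t : ℕ} {S : Finset V}
    (hS : ball G o t ⊆ S) : ∑ x ∈ S, G.degree x * kernel G t x o = G.degree o := by
  classical
  induction t with
  | zero =>
    have : o ∈ S := hS (by simp [ball])
    simp only [kernel, Function.iterate_zero, id_eq, Pi.single_apply]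
    simp [this]
  | succ t ih =>
    rw [← ih ((ball_mono o t.le_succ).trans hS)]
    simp only [kernel_succ]
    exact sum_degree_mul_avg hd fun x hx =>
      (closedNbhd_subset_ball (mem_ball_of_kernel_ne_zero hx)).trans hS

section Entropy

open Real

/-- Reversibility turns the entropy of the law p_t(o,·) into that of the density p_t(·,o); the ratio
of degrees costs at most log M. -/
lemma sum_degree_negMulLog_kernel_le (hd : ∀ x, 0 < G.degree x) {M K : ℝ}
    (hM : ∀ x, (G.degree x : ℝ) ≤ M) {o : V} {t : ℕ} {S : Finset V}
    (hK : ∑ x ∈ S, negMulLog (kernel G t o x) ≤ K) :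
    ∑ x ∈ S, G.degree x * negMulLog (kernel G t x o) ≤ G.degree o * (K + log M) := by
  have hpos : ∀ v, (0 : ℝ) < G.degree v := fun v => by exact_mod_cast hd v
  have h1 : ∀ v, (1 : ℝ) ≤ G.degree v := fun v => by exact_mod_cast hd v
  have hM1 : 0 ≤ log M := log_nonneg ((h1 o).trans (hM o))
  have hpt : ∀ x, G.degree x * negMulLog (kernel G t x o)
      ≤ G.degree o * negMulLog (kernel G t o x) + G.degree o * (kernel G t o x * log M) := by
    intro x
    have hk : kernel G t x o = G.degree o / G.degree x * kernel G t o x := by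
      have := degree_mul_kernel hd t x o
      have := (hpos x).ne'
      field_simp
      linarith
    have hlog : log (G.degree x) - log (G.degree o) ≤ log M := by
      have := log_le_log (hpos x) (hM x)
      have := log_nonneg (h1 o)
      linarith
    have hk0 := kernel_nonneg (G := G) t o x
    have e : G.degree x * negMulLog (kernel G t x o) = G.degree o * negMulLog (kernel G t o x)
        + G.degree o * (kernel G t o x * (log (G.degree x) - log (G.degree o))) := by
      rw [hk, negMulLog_mul]
      simp only [negMulLog]
      rw [log_div (hpos o).ne' (hpos x).ne']
      have := (hpos x).ne'
      field_simp
      ring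
    rw [e]
    have := (hpos o).le
    gcongr
  refine (Finset.sum_le_sum fun x _ => hpt x).trans ?_
  rw [Finset.sum_add_distrib, ← Finset.mul_sum, ← Finset.mul_sum, ← Finset.sum_mul, mul_add]
  have h3 := sum_kernel_le_one hd S t o
  have h4 := mul_le_mul_of_nonneg_right h3 hM1
  have := (hpos o).le
  gcongr
  linarith

/-- Invariance of the degree measure makes the total entropy telescope, its increment at time t
being the summed local production; it starts at zero. -/
lemma sum_gradient_le (hd : ∀ x, 0 < G.degree x) (o : V) {l : ℝ} (hl : 0 ≤ l) {T : ℕ}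
    {S : Finset V} (hS : ball G o T ⊆ S) :
    ∑ t ∈ Finset.range T, (l * ∑ x ∈ S, ∑ y ∈ G.neighborFinset x,
        |kernel G t x o - kernel G t y o| - 4 * l ^ 2 * G.degree o)
      ≤ ∑ x ∈ S, G.degree x * negMulLog (kernel G T x o) := by
  classical
  induction T with
  | zero =>
    rw [Finset.sum_range_zero]
    refine (Finset.sum_eq_zero fun x _ => ?_).ge
    simp only [kernel, Function.iterate_zero, id_eq, Pi.single_apply]
    split_ifs <;> simp
  | succ T ih =>
    have hS' : ball G o T ⊆ S := (ball_mono o T.le_succ).trans hS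
    have hsupp : ∀ x, kernel G T x o ≠ 0 → closedNbhd G x ⊆ S := fun x hx =>
      (closedNbhd_subset_ball (mem_ball_of_kernel_ne_zero hx)).trans hS
    rw [Finset.sum_range_succ]
    have h1 : ∑ x ∈ S, G.degree x * negMulLog (kernel G T x o)
        = ∑ x ∈ S, G.degree x * avg G (fun y => negMulLog (kernel G T y o)) x :=
      (sum_degree_mul_avg hd fun x hx => hsupp x fun h => hx (by simp [h])).symm
    have h2 := sum_degree_mul_kernel hd o hS
    have h3 := Finset.sum_le_sum fun (x : V) (_ : x ∈ S) =>
      mul_le_mul_of_nonneg_left (gradient_le_negMulLog_avg hd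
        (fun y => kernel_nonneg (G := G) T y o) l hl x) (Nat.cast_nonneg (G.degree x))
    simp only [← kernel_succ] at h3
    have h4 : ∀ x, (G.degree x : ℝ) * (l * ((∑ y ∈ G.neighborFinset x,
        |kernel G T x o - kernel G T y o|) / G.degree x) - 4 * l ^ 2 * kernel G (T + 1) x o)
        = l * (∑ y ∈ G.neighborFinset x, |kernel G T x o - kernel G T y o|)
          - 4 * l ^ 2 * (G.degree x * kernel G (T + 1) x o) := by
      intro x
      have : (G.degree x : ℝ) ≠ 0 := by have := hd x; positivity
      field_simp
    simp only [h4, mul_sub, Finset.sum_sub_distrib, ← Finset.mul_sum, h2] at h3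
    have := ih hS'
    linarith

/-- The walk started from a fixed vertex spreads out: its densities have arbitrarily small
gradient. -/
lemma exists_gradient_le (hd : ∀ x, 0 < G.degree x) (hconn : G.Connected)
    (hG : HasNonnegOllivierRicci G) {m M : ℝ} (h0 : 0 < m) (h1 : m ≤ 1 / 2)
    (hm : ∀ x, m ≤ 1 / (2 * G.degree x)) (hM : ∀ x, (G.degree x : ℝ) ≤ M) (o : V) {δ : ℝ}
    (hδ : 0 < δ) :
    ∃ (t : ℕ) (S : Finset V), ball G o t ⊆ S ∧ ∑ x ∈ S, ∑ y ∈ G.neighborFinset x,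
      |kernel G t x o - kernel G t y o| ≤ δ * G.degree o := by
  by_contra! hcon
  have hM0 : 0 ≤ M := (Nat.cast_nonneg _).trans (hM o)
  have hdo : (0 : ℝ) < G.degree o := by exact_mod_cast hd o
  have key : ∀ T : ℕ, T * (δ ^ 2 / 16)
      ≤ 4 * (M + 1) * ∑ s ∈ Finset.range T, heat m s 1 + log M := by
    intro T
    -- l = δ/8 maximises lδ - 4l², with value δ²/16.
    have a := sum_gradient_le hd o (l := δ / 8) (by positivity) (Finset.Subset.refl (ball G o T))
    have b := sum_degree_negMulLog_kernel_le hd hM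
      (sum_negMulLog_kernel_le hd hconn hG h0.le h1 hm hM (ball G o T) T o)
    have c : ∑ t ∈ Finset.range T, (G.degree o * (δ ^ 2 / 16)) ≤ ∑ t ∈ Finset.range T,
        (δ / 8 * ∑ x ∈ ball G o T, ∑ y ∈ G.neighborFinset x,
        |kernel G t x o - kernel G t y o| - 4 * (δ / 8) ^ 2 * G.degree o) := by
      refine Finset.sum_le_sum fun t ht => ?_
      have := hcon t (ball G o T) (ball_mono o (Finset.mem_range.1 ht).le)
      nlinarith
    rw [Finset.sum_const, Finset.card_range, nsmul_eq_mul] at c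
    refine le_of_mul_le_mul_left ?_ hdo
    linarith
  set B := 4 * (M + 1) with hB
  have hBpos : 0 < B := by positivity
  -- R makes the linear coefficient B/R of the entropy bound smaller than δ²/32, so large T
  -- contradicts linear production at rate δ²/16.
  obtain ⟨R, hR⟩ := exists_nat_gt (B / (δ ^ 2 / 32))
  rw [div_lt_iff₀ (by positivity)] at hR
  have hRpos : (0 : ℝ) < R := by
    by_contra h
    have : (R : ℝ) * (δ ^ 2 / 32) ≤ 0 := mul_nonpos_of_nonpos_of_nonneg (not_lt.1 h) (by positivity)
    linarith
  obtain ⟨T, hT⟩ := exists_nat_gt ((B * (R ^ 2 / (2 * m)) + R * log M) / (R * (δ ^ 2 / 16) - B))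
  have hpos : 0 < R * (δ ^ 2 / 16) - B := by nlinarith
  rw [div_lt_iff₀ hpos] at hT
  have h2 := mul_le_mul_of_nonneg_left (sum_heat_one_le h0 h1 T R) hBpos.le
  have h3 := mul_le_mul_of_nonneg_left (key T) hRpos.le
  linarith

end Entropy

/-! ### Co-area inequality. -/

/-- The one-sided edge boundary is counted by ordered pairs. -/
lemma ncard_edgeBoundary_le {V : Type*} (G : SimpleGraph V) [G.LocallyFinite] [DecidableEq V]
    (W : Finset V) :
    (edgeBoundary G W).ncard ≤ ∑ x ∈ W, (G.neighborFinset x \ W).card := by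
  have hsub : edgeBoundary G W
      ⊆ ((W.biUnion fun x => (G.neighborFinset x \ W).image fun y => s(x, y)) : Finset (Sym2 V)) := by
    rintro e ⟨he, x, hx, y, hy, rfl⟩
    simp only [Finset.coe_biUnion, Set.mem_iUnion, Finset.mem_coe, Finset.mem_image,
      Finset.mem_sdiff, SimpleGraph.mem_neighborFinset]
    exact ⟨x, hx, y, ⟨by simpa using he, hy⟩, rfl⟩
  refine (Set.ncard_le_ncard hsub (Finset.finite_toSet _)).trans ?_
  rw [Set.ncard_coe_finset]
  exact Finset.card_biUnion_le.trans (Finset.sum_le_sum fun x _ => Finset.card_image_le)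

/-- The co-area inequality for a function whose support has volume at most `n`. -/
lemma mul_sum_degree_le_sum_gradient {n : ℕ} {φ : ℝ}
    (hφ : ∀ W : Finset V, W.Nonempty → vertexVolume G W ≤ n →
      φ * vertexVolume G W ≤ (edgeBoundary G W).ncard)
    {S : Finset V} {f : V → ℝ} (hf : ∀ x, 0 ≤ f x) (hfS : ∀ x, f x ≠ 0 → x ∈ S)
    (hvol : ∀ W : Finset V, (∀ x ∈ W, f x ≠ 0) → vertexVolume G W ≤ n) :
    φ * ∑ x ∈ S, G.degree x * f x ≤ ∑ x ∈ S, ∑ y ∈ G.neighborFinset x, |f x - f y| := by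
  classical
  -- Layer-cake by induction on the size of the support: subtract the least positive value c on the
  -- support W, which removes at least one vertex from it.
  induction hk : (S.filter fun x => f x ≠ 0).card using Nat.strong_induction_on generalizing f with
  | _ k ih =>
    set W := S.filter fun x => f x ≠ 0 with hW
    have hmem : ∀ x, x ∈ W ↔ f x ≠ 0 := fun x => by
      simp only [hW, Finset.mem_filter, and_iff_right_iff_imp]; exact hfS x
    rcases W.eq_empty_or_nonempty with hem | hne
    · have hz : ∀ x, f x = 0 := fun x => by
        by_contra h
        have := (hmem x).2 h
        simp [hem] at this
      simp [hz]
    obtain ⟨v, hv, hmin⟩ := Finset.exists_min_image W f hne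
    have hc : 0 < f v := (hf v).lt_of_ne ((hmem v).1 hv).symm
    set c := f v
    set g : V → ℝ := fun x => f x - if x ∈ W then c else 0 with hg
    have hin : ∀ x ∈ W, g x = f x - c := fun x hx => by simp [hg, hx]
    have hout : ∀ x, x ∉ W → g x = 0 ∧ f x = 0 := fun x hx => by
      have : f x = 0 := by
        by_contra h
        exact hx ((hmem x).2 h)
      simp [hg, hx, this]
    have hg0 : ∀ x, 0 ≤ g x := by
      intro x
      by_cases hx : x ∈ W
      · rw [hin x hx]; exact sub_nonneg.2 (hmin x hx)
      · rw [(hout x hx).1]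
    have hgf : ∀ x, g x ≠ 0 → f x ≠ 0 := fun x hx h =>
      hx (hout x fun hxW => (hmem x).1 hxW h).1
    have hlt : (S.filter fun x => g x ≠ 0).card < k := by
      rw [← hk]
      refine Finset.card_lt_card ⟨fun x hx => ?_, fun h => ?_⟩
      · rw [Finset.mem_filter] at hx
        exact (hmem x).2 (hgf x hx.2)
      · have := (Finset.mem_filter.1 (h hv)).2
        rw [hin v hv] at this
        exact this (sub_self _)
    have hrec := ih _ hlt hg0 (fun x hx => hfS x (hgf x hx))
      (fun W' hW' => hvol W' fun x hx => hgf x (hW' x hx)) rfl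
    have hWS : W ⊆ S := Finset.filter_subset _ _
    have hbd : φ * vertexVolume G W ≤ ∑ x ∈ W, ((G.neighborFinset x \ W).card : ℝ) := by
      refine (hφ W hne (hvol W fun x hx => (hmem x).1 hx)).trans ?_
      exact_mod_cast ncard_edgeBoundary_le G W
    have hleft : ∑ x ∈ S, G.degree x * f x
        = ∑ x ∈ S, G.degree x * g x + c * vertexVolume G W := by
      have h1 : ∀ x, (G.degree x : ℝ) * f x
          = G.degree x * g x + if x ∈ W then c * G.degree x else 0 := by
        intro x
        by_cases hx : x ∈ W
        · rw [hin x hx, if_pos hx]; ring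
        · rw [(hout x hx).1, (hout x hx).2, if_neg hx]; ring
      simp only [h1, Finset.sum_add_distrib, vertexVolume, Nat.cast_sum, Finset.mul_sum]
      rw [← Finset.sum_filter, Finset.filter_mem_eq_inter, Finset.inter_eq_right.2 hWS]
    -- Only ordered pairs leaving W are credited with c; the reversed pairs are merely bounded
    -- below.
    have hright : ∑ x ∈ S, ∑ y ∈ G.neighborFinset x, |g x - g y|
          + c * ∑ x ∈ W, ((G.neighborFinset x \ W).card : ℝ)
        ≤ ∑ x ∈ S, ∑ y ∈ G.neighborFinset x, |f x - f y| := by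
      have h1 : c * ∑ x ∈ W, ((G.neighborFinset x \ W).card : ℝ)
          = ∑ x ∈ S, ∑ y ∈ G.neighborFinset x, if x ∈ W ∧ y ∉ W then c else 0 := by
        rw [Finset.mul_sum]
        refine Finset.sum_subset_zero_on_sdiff hWS (fun x hx => ?_) (fun x hx => ?_)
        · rw [Finset.mem_sdiff] at hx
          simp [hx.2]
        · simp only [hx, true_and]
          rw [← Finset.sum_filter, Finset.sum_const, nsmul_eq_mul, mul_comm,
            Finset.sdiff_eq_filter]
      rw [h1, ← Finset.sum_add_distrib]
      refine Finset.sum_le_sum fun x _ => ?_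
      rw [← Finset.sum_add_distrib]
      refine Finset.sum_le_sum fun y _ => ?_
      by_cases hx : x ∈ W <;> by_cases hy : y ∈ W
      · simp [hx, hy, hin]
      · have := hmin x hx
        simp only [hx, hy, not_false_eq_true, and_self, if_true, hin, (hout y hy).1,
          (hout y hy).2, sub_zero]
        rw [abs_of_nonneg (sub_nonneg.2 this), abs_of_nonneg (hf x)]
        linarith
      · have := hmin y hy
        simp only [hx, hy, false_and, if_false, hin, (hout x hx).1, (hout x hx).2, zero_sub,
          abs_neg, add_zero]
        rw [abs_of_nonneg (sub_nonneg.2 this), abs_of_nonneg (hf y)]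
        linarith
      · simp [hx, (hout x hx).1, (hout x hx).2, (hout y hy).1, (hout y hy).2]
    have := mul_le_mul_of_nonneg_left hbd hc.le
    rw [hleft, mul_add]
    linarith

/-! ### From regularity to isoperimetry. -/

/-- The isoperimetric profile is bounded by the total variation distance between the walks started
from adjacent vertices. -/
lemma le_two_mul_heat (hd : ∀ x, 0 < G.degree x) (hconn : G.Connected)
    (hG : HasNonnegOllivierRicci G) {m M : ℝ} (h0 : 0 < m) (h1 : m ≤ 1 / 2)
    (hm : ∀ x, m ≤ 1 / (2 * G.degree x)) (hM : ∀ x, (G.degree x : ℝ) ≤ M) {n t : ℕ}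
    (hn : M * (M + 1) ^ t ≤ n) {φ : ℝ}
    (hφ : ∀ W : Finset V, W.Nonempty → vertexVolume G W ≤ n →
      φ * vertexVolume G W ≤ (edgeBoundary G W).ncard) :
    φ ≤ 2 * heat m t 1 := by
  classical
  obtain ⟨o⟩ := hconn.nonempty
  have hM0 : 0 ≤ M := (Nat.cast_nonneg _).trans (hM o)
  have hdo : (0 : ℝ) < G.degree o := by exact_mod_cast hd o
  refine le_of_forall_pos_le_add fun δ hδ => ?_
  obtain ⟨s, S, hS, hgrad⟩ := exists_gradient_le hd hconn hG h0 h1 hm hM o hδ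
  set F : V → ℝ := fun x => kernel G s x o with hF
  have hF0 : ∀ x, 0 ≤ F x := fun x => kernel_nonneg s x o
  have hFS : ∀ x, F x ≠ 0 → x ∈ S := fun x hx => hS (mem_ball_of_kernel_ne_zero hx)
  have hFsum : ∑ x ∈ S, G.degree x * F x = G.degree o := sum_degree_mul_kernel hd o hS
  choose Z hZ using exists_sum_kernel_eq_one hd t
  set Y := S.biUnion Z with hY
  have hone : ∀ x ∈ S, ∑ z ∈ Y, kernel G t x z = 1 := fun x hx =>
    hZ x Y (Finset.subset_biUnion_of_mem Z hx)
  -- The volume is controlled by the radius t alone, however large the support of F is.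
  have hvol : ∀ z, ∀ W : Finset V, (∀ x ∈ W, F x * kernel G t x z ≠ 0) →
      vertexVolume G W ≤ n := by
    intro z W hW
    have hsub : W ⊆ ball G z t := fun x hx =>
      mem_ball_of_kernel_ne_zero (right_ne_zero_of_mul (hW x hx))
    have : (vertexVolume G W : ℝ) ≤ n := by
      calc (vertexVolume G W : ℝ) = ∑ w ∈ W, (G.degree w : ℝ) := by simp [vertexVolume]
        _ ≤ ∑ w ∈ W, M := Finset.sum_le_sum fun w _ => hM w
        _ = W.card * M := by simp
        _ ≤ (ball G z t).card * M := by gcongr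
        _ ≤ (M + 1) ^ t * M := by gcongr; exact card_ball_le hM z t
        _ ≤ n := by rwa [mul_comm]
    exact_mod_cast this
  have hco := Finset.sum_le_sum fun (z : V) (_ : z ∈ Y) =>
    mul_sum_degree_le_sum_gradient hφ (S := S) (f := fun x => F x * kernel G t x z)
      (fun x => mul_nonneg (hF0 x) (kernel_nonneg t x z))
      (fun x hx => hFS x (left_ne_zero_of_mul hx)) (hvol z)
  have hleft : ∑ z ∈ Y, φ * ∑ x ∈ S, G.degree x * (F x * kernel G t x z) = φ * G.degree o := by
    rw [← Finset.mul_sum, Finset.sum_comm, ← hFsum]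
    congr 1
    refine Finset.sum_congr rfl fun x hx => ?_
    rw [← Finset.mul_sum, ← Finset.mul_sum, hone x hx, mul_one]
  -- Discrete Leibniz rule: one term costs the gradient of F, the other the ℓ¹ distance between
  -- kernels from adjacent vertices.
  have hright : ∑ z ∈ Y, ∑ x ∈ S, ∑ y ∈ G.neighborFinset x,
      |F x * kernel G t x z - F y * kernel G t y z|
      ≤ ∑ x ∈ S, ∑ y ∈ G.neighborFinset x, (|F x - F y| + F x * (2 * heat m t 1)) := by
    rw [Finset.sum_comm]
    refine Finset.sum_le_sum fun x _ => ?_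
    rw [Finset.sum_comm]
    refine Finset.sum_le_sum fun y hy => ?_
    calc ∑ z ∈ Y, |F x * kernel G t x z - F y * kernel G t y z|
        ≤ ∑ z ∈ Y, (|F x - F y| * kernel G t y z + F x * |kernel G t x z - kernel G t y z|) := by
          refine Finset.sum_le_sum fun z _ => ?_
          have : F x * kernel G t x z - F y * kernel G t y z
            = (F x - F y) * kernel G t y z + F x * (kernel G t x z - kernel G t y z) := by ring
          rw [this]
          refine (abs_add_le _ _).trans_eq ?_
          rw [abs_mul, abs_mul, abs_of_nonneg (kernel_nonneg t y z), abs_of_nonneg (hF0 x)]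
      _ ≤ |F x - F y| * 1 + F x * (2 * heat m t 1) := by
          rw [Finset.sum_add_distrib, ← Finset.mul_sum, ← Finset.mul_sum]
          have a := sum_kernel_le_one hd Y t y
          have b := sum_abs_kernel_sub_le hd hconn hG h0.le h1 hm t x y Y
          rw [SimpleGraph.dist_eq_one_iff_adj.2 (by simpa using hy)] at b
          exact add_le_add (mul_le_mul_of_nonneg_left a (abs_nonneg _))
            (mul_le_mul_of_nonneg_left b (hF0 x))
      _ = _ := by rw [mul_one]
  have hheat : ∑ x ∈ S, ∑ y ∈ G.neighborFinset x, F x * (2 * heat m t 1)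
      = G.degree o * (2 * heat m t 1) := by
    rw [← hFsum, Finset.sum_mul]
    refine Finset.sum_congr rfl fun x _ => ?_
    rw [Finset.sum_const, SimpleGraph.card_neighborFinset_eq_degree, nsmul_eq_mul, mul_assoc]
  simp only [Finset.sum_add_distrib, hheat] at hright
  rw [hleft] at hco
  refine le_of_mul_le_mul_right ?_ hdo
  linarith

lemma vertexVolume_pos (hd : ∀ x, 0 < G.degree x) {W : Finset V} (hW : W.Nonempty) :
    0 < vertexVolume G W :=
  Finset.sum_pos (fun x _ => hd x) hW

lemma isoperimetricProfile_le {n : ℕ} {W : Finset V} (hW : W.Nonempty)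
    (hn : vertexVolume G W ≤ n) :
    isoperimetricProfile G n ≤ ((edgeBoundary G W).ncard : ℝ≥0∞) / (vertexVolume G W : ℝ≥0∞) :=
  iInf_le_of_le W (iInf_le_of_le hW (iInf_le_of_le hn le_rfl))

lemma isoperimetricProfile_le_one {n : ℕ} {v : V} (hv : G.degree v ≤ n) :
    isoperimetricProfile G n ≤ 1 := by
  classical
  refine (isoperimetricProfile_le (Finset.singleton_nonempty v)
    (by simpa [vertexVolume] using hv)).trans ?_
  refine ENNReal.div_le_of_le_mul ?_
  rw [one_mul]
  have h := ncard_edgeBoundary_le G {v}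
  rw [Finset.sum_singleton] at h
  have h2 : (G.neighborFinset v \ {v}).card ≤ G.degree v := by
    rw [← SimpleGraph.card_neighborFinset_eq_degree]
    exact Finset.card_le_card Finset.sdiff_subset
  have h3 : vertexVolume G {v} = G.degree v := by simp [vertexVolume]
  rw [h3]
  exact_mod_cast h.trans h2

/-- A graph with all degrees equal to one is a single edge. -/
lemma isoperimetricProfile_eq_zero [Nonempty V] (hone : ∀ x, G.degree x = 1) {n : ℕ}
    (hn : 2 ≤ n) : isoperimetricProfile G n = 0 := by
  classical
  obtain ⟨v⟩ := ‹Nonempty V›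
  have huniq : ∀ x y z, G.Adj x y → G.Adj x z → y = z := by
    intro x y z hy hz
    have h : (G.neighborFinset x).card ≤ 1 := by
      rw [SimpleGraph.card_neighborFinset_eq_degree, hone]
    exact Finset.card_le_one.1 h y (by simpa using hy) z (by simpa using hz)
  obtain ⟨w, hw⟩ := (G.degree_pos_iff_exists_adj v).1 (by rw [hone]; norm_num)
  have hbd : edgeBoundary G {v, w} = ∅ := by
    rw [Set.eq_empty_iff_forall_notMem]
    rintro e ⟨he, x, hx, y, hy, rfl⟩
    rw [SimpleGraph.mem_edgeSet] at he
    simp only [Finset.mem_insert, Finset.mem_singleton, not_or] at hx hy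
    rcases hx with rfl | rfl
    · exact hy.2 (huniq _ _ _ he hw)
    · exact hy.1 (huniq _ _ _ he hw.symm)
  have hvol : vertexVolume G {v, w} ≤ n := by
    rw [vertexVolume, Finset.sum_pair hw.ne, hone, hone]
    exact hn
  have := isoperimetricProfile_le (Finset.insert_nonempty v {w}) hvol
  simpa [hbd] using this

lemma toReal_isoperimetricProfile_mul_le (hd : ∀ x, 0 < G.degree x) {n : ℕ} {W : Finset V}
    (hW : W.Nonempty) (hn : vertexVolume G W ≤ n) :
    (isoperimetricProfile G n).toReal * vertexVolume G W ≤ (edgeBoundary G W).ncard := by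
  have hpos := vertexVolume_pos hd hW
  have h : isoperimetricProfile G n * vertexVolume G W ≤ (edgeBoundary G W).ncard :=
    (ENNReal.le_div_iff_mul_le (Or.inl (by exact_mod_cast hpos.ne')) (Or.inl (by simp))).1
      (isoperimetricProfile_le hW hn)
  simpa using ENNReal.toReal_mono (by simp) h

/-- The numerical optimisation over the number of steps and over the barrier. -/
lemma exists_heat_le {M : ℝ} (hM : 2 ≤ M) {n : ℕ} (hn : 2 ≤ n)
    (hlarge : 2 * M < Real.log n / Real.log M) :
    ∃ t : ℕ, M * (M + 1) ^ t ≤ n ∧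
      heat (1 / (2 * M)) t 1 ≤ 5 * Real.sqrt (M * Real.log M / Real.log n) := by
  have hlogM : 0 < Real.log M := Real.log_pos (by linarith)
  have hn0 : (0 : ℝ) < n := by positivity
  set X := Real.log n / Real.log M with hX
  have hXpos : 0 < X := by linarith
  set q := Real.sqrt (X / M) with hq
  have hq1 : 1 ≤ q := by
    rw [hq, Real.one_le_sqrt, le_div_iff₀ (by linarith)]
    linarith
  have hq2 : q ^ 2 = X / M := Real.sq_sqrt (by positivity)
  have hrhs : Real.sqrt (M * Real.log M / Real.log n) = 1 / q := by
    rw [one_div, hq, ← Real.sqrt_inv, hX]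
    congr 1
    field_simp
  -- As M + 1 ≤ M² for M ≥ 2, it suffices that M^(2t+1) ≤ n, that is 2t + 1 ≤ X.
  set t := ⌊(X - 1) / 2⌋₊ with ht
  have ht1 : (t : ℝ) ≤ (X - 1) / 2 := Nat.floor_le (by linarith)
  have ht2 : X / 3 ≤ t + 1 := by
    have := Nat.lt_floor_add_one ((X - 1) / 2)
    rw [← ht] at this
    linarith
  -- R ≈ √(X/M) balances 1/R against RM/(t + 1); these are at most 2/q and 3/q, whence the constant
  -- 5.
  set R := ⌊q⌋₊ with hR
  have hR1 : (R : ℝ) ≤ q := Nat.floor_le (by linarith)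
  have hR2 : q / 2 ≤ R := by
    have h1 := Nat.lt_floor_add_one q
    have h2 : (1 : ℝ) ≤ R := by exact_mod_cast (Nat.one_le_floor_iff q).2 hq1
    rw [← hR] at h1
    linarith
  have hRpos : (0 : ℝ) < R := by linarith
  refine ⟨t, ?_, ?_⟩
  · have h1 : M * (M + 1) ^ t ≤ M ^ (2 * t + 1) := by
      rw [pow_succ', pow_mul]
      gcongr
      nlinarith
    refine h1.trans ?_
    rw [← Real.log_le_log_iff (by positivity) hn0, Real.log_pow, ← le_div_iff₀ hlogM, ← hX]
    push_cast
    linarith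
  · have h := heat_one_le (m := 1 / (2 * M)) (by positivity)
      (by rw [div_le_div_iff_of_pos_left] <;> linarith) t R
    have ht0 : (0 : ℝ) < t + 1 := by positivity
    have e : (R : ℝ) ^ 2 / (2 * (1 / (2 * M))) = R ^ 2 * M := by field_simp
    rw [e] at h
    have h2 : heat (1 / (2 * M)) t 1 ≤ 1 / R + R * M / (t + 1) := by
      rw [div_add_div _ _ hRpos.ne' ht0.ne', le_div_iff₀ (by positivity)]
      linarith
    have h3 : 1 / (R : ℝ) ≤ 2 / q := by
      rw [div_le_div_iff₀ hRpos (by linarith)]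
      linarith
    have h4 : R * M / (t + 1) ≤ 3 / q := by
      rw [div_le_div_iff₀ ht0 (by linarith)]
      have hXq : X = q ^ 2 * M := by rw [hq2]; field_simp
      have : R * M * q ≤ q * M * q := by gcongr
      nlinarith
    rw [hrhs]
    have : 5 * (1 / q) = 2 / q + 3 / q := by ring
    linarith

end LazyWalk

theorem mainTheorem3 :
    ∃ C : ℝ, 0 < C ∧
      ∀ (V : Type*) [Nontrivial V] (G : SimpleGraph V) [G.LocallyFinite] (M : ℝ),
        G.Connected →
        (∀ v : V, (G.degree v : ℝ) ≤ M) →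
        HasNonnegOllivierRicci G →
        ∀ n : ℕ, 2 ≤ n → (∃ v : V, G.degree v ≤ n) →
          isoperimetricProfile G n ≤
            ENNReal.ofReal (C * Real.sqrt (M * Real.log M / Real.log n)) := by
  refine ⟨10, by norm_num, fun V _ G _ M hconn hM hG n hn ⟨v, hv⟩ => ?_⟩
  have hd : ∀ x, 0 < G.degree x := fun x => hconn.preconnected.degree_pos_of_nontrivial x
  have hlogn : 0 < Real.log n := Real.log_pos (by exact_mod_cast hn)
  -- For M = 1 the right side is zero, so this case needs the profile to vanish exactly.
  rcases lt_or_ge M 2 with hM2 | hM2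
  · have hone : ∀ x, G.degree x = 1 := fun x => by
      have h1 : (G.degree x : ℝ) < 2 := (hM x).trans_lt hM2
      have h2 : G.degree x < 2 := by exact_mod_cast h1
      have := hd x
      omega
    rw [LazyWalk.isoperimetricProfile_eq_zero hone hn]
    exact zero_le
  have hlogM : 0 < Real.log M := Real.log_pos (by linarith)
  have hle1 := LazyWalk.isoperimetricProfile_le_one hv
  -- For log n ≤ 2M log M the square root is at least √(1/2), and the trivial bound Φ ≤ 1 suffices.
  rcases le_or_gt (Real.log n / Real.log M) (2 * M) with hsmall | hlarge
  · refine hle1.trans ?_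
    rw [← ENNReal.ofReal_one]
    refine ENNReal.ofReal_le_ofReal ?_
    have : 1 / 10 ≤ Real.sqrt (M * Real.log M / Real.log n) := by
      refine Real.le_sqrt_of_sq_le ?_
      rw [div_le_iff₀ hlogM] at hsmall
      rw [le_div_iff₀ hlogn]
      nlinarith
    linarith
  obtain ⟨t, ht, hheat⟩ := LazyWalk.exists_heat_le hM2 hn hlarge
  have hm : ∀ x, 1 / (2 * M) ≤ 1 / (2 * (G.degree x : ℝ)) := fun x => by
    have : (0 : ℝ) < G.degree x := by exact_mod_cast hd x
    have := hM x
    gcongr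
  have key := LazyWalk.le_two_mul_heat hd hconn hG (m := 1 / (2 * M)) (by positivity)
    (by rw [div_le_div_iff_of_pos_left] <;> linarith) hm hM ht
    fun W hW hWn => LazyWalk.toReal_isoperimetricProfile_mul_le hd hW hWn
  rw [← ENNReal.ofReal_toReal (ne_top_of_le_ne_top ENNReal.one_ne_top hle1)]
  exact ENNReal.ofReal_le_ofReal (by linarith)
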